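/- Let $X$ be a compact metric space, $T:X\to X$ a homeomorphism and $\mu$ an ergodic $T$-invariant Borel probability measure. Let $A:X\to \mathrm{GL}^+(2,\mathbb R)$ (real $2\times2$ matrices with positive determinant) be continuous. Write $A^n(x)=A(T^{n-1}x)\cdots A(Tx)A(x)$ and $A^{-n}(x)=A(T^{-n}x)^{-1}\cdots A(T^{-1}x)^{-1}$ for $n\ge 1$, and let $\|\cdot\|$ be the Euclidean operator norm. Assume that the cocycle generated by $A$ over $T$ has dominated splitting, i.e. there is a continuous decomposition $\mathbb R^2=E(x)\oplus F(x)$ into lines with $A(x)E(x)=E(Tx)$ and $A(x)F(x)=F(Tx)$ for all $x\in X$, such that for every $x\in X$ there is an integer $l\ge1$ with $$\|A^l(x)|_{E(x)}\|\cdot\|A^{-l}(T^lx)|_{F(T^lx)}\|<\tfrac12 .$$ For $\theta\in\mathbb R$ let $A_\theta(x)=A(x)R_\theta$, where $R_\theta$ is the rotation of angle $\theta$. For a cocycle $B$, let $\lambda^+(B)$ and $\lambda^-(B)$ denote the $\mu$-almost everywhere constant values of $\lim_{n\to\infty}\frac1n\log\|B^n(x)\|$ and $\lim_{n\to\infty}\frac1n\log\|B^{-n}(x)\|^{-1}$.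 Then there are $\varepsilon>0$ and an open interval $I\subset\mathbb R$ of length $\varepsilon$ with $0$ as an endpoint such that the exponents $\lambda^\pm(A)$ and $\lambda^\pm(A_\theta)$, $\theta\in I$, exist and, for every $\theta\in I$, $$\lambda^+(A_\theta)<\lambda^+(A)\qquad\text{and}\qquad \lambda^-(A_\theta)>\lambda^-(A).$$ In particular, neither $\lambda^+(A_\theta)$ nor $\lambda^-(A_\theta)$ is constant in $\theta\in\{0\}\cup I$. -/

import Mathlib

open MeasureTheory Filter Topology
open scoped MatrixGroups

noncomputable section

namespace LinearCocycle

/-- The Euclidean plane. -/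
abbrev Plane : Type := EuclideanSpace ℝ (Fin 2)

/-- The linear map of the Euclidean plane given by an invertible real matrix. Its norm is the
operator norm for the Euclidean norm. -/
def toMap (M : GL (Fin 2) ℝ) : Plane →L[ℝ] Plane :=
  Matrix.toEuclideanCLM (n := Fin 2) (𝕜 := ℝ) (M : Matrix (Fin 2) (Fin 2) ℝ)

/-- The rotation matrix `R_θ` of angle `θ`. -/
def rotation (θ : ℝ) : GL (Fin 2) ℝ :=
  Matrix.GeneralLinearGroup.mkOfDetNeZero
    !![Real.cos θ, -Real.sin θ; Real.sin θ, Real.cos θ]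
    (by
      have h : Real.cos θ * Real.cos θ + Real.sin θ * Real.sin θ = 1 := by
        nlinarith [Real.sin_sq_add_cos_sq θ]
      simp [Matrix.det_fin_two_of, h])

variable {X : Type*}

/-- The cocycle `A_θ(x) = A(x) R_θ`. -/
def rotate (A : X → GL (Fin 2) ℝ) (θ : ℝ) (x : X) : GL (Fin 2) ℝ :=
  A x * rotation θ

section Iterates

variable [TopologicalSpace X] (T : X ≃ₜ X) (A : X → GL (Fin 2) ℝ)

/-- Forward iterates: `A^n(x) = A(T^{n-1} x) ⋯ A(T x) A(x)`. -/
def iter : ℕ → X → GL (Fin 2) ℝ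
  | 0, _ => 1
  | n + 1, x => A (T^[n] x) * iter n x

/-- Backward iterates: `A^{-n}(x) = A(T^{-n} x)⁻¹ ⋯ A(T^{-1} x)⁻¹`. -/
def iterNeg : ℕ → X → GL (Fin 2) ℝ
  | 0, _ => 1
  | n + 1, x => (A (T.symm^[n + 1] x))⁻¹ * iterNeg n x

/-- A field of linear subspaces is a continuous line field if every fibre is one-dimensional and,
near every point, the fibres are spanned by a continuous nowhere vanishing vector field. -/
def IsContinuousLineField (E : X → Submodule ℝ Plane) : Prop :=
  (∀ x, Module.finrank ℝ (E x) = 1) ∧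
  ∀ x₀, ∃ U ∈ 𝓝 x₀, ∃ u : X → Plane, ContinuousOn u U ∧
    ∀ x ∈ U, u x ≠ 0 ∧ E x = Submodule.span ℝ {u x}

/-- The cocycle generated by `A` over `T` has dominated splitting: there is a continuous invariant
decomposition `ℝ² = E(x) ⊕ F(x)` into lines such that, for every `x`, some `l ≥ 1` satisfies
`‖A^l(x)|E(x)‖ * ‖A^{-l}(T^l x)|F(T^l x)‖ < 1/2`. -/
def HasDominatedSplitting : Prop :=
  ∃ E F : X → Submodule ℝ Plane,
    IsContinuousLineField E ∧ IsContinuousLineField F ∧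
    (∀ x, IsCompl (E x) (F x)) ∧
    (∀ x, (E x).map (toMap (A x)).toLinearMap = E (T x)) ∧
    (∀ x, (F x).map (toMap (A x)).toLinearMap = F (T x)) ∧
    ∀ x, ∃ l : ℕ, 1 ≤ l ∧
      ‖(toMap (iter T A l x)).comp (E x).subtypeL‖ *
        ‖(toMap (iterNeg T A l (T^[l] x))).comp (F (T^[l] x)).subtypeL‖ < 1 / 2

variable [MeasurableSpace X] (μ : Measure X)

/-- `L` is the upper Lyapunov exponent `λ⁺(A)` with respect to `μ`: for `μ`-almost every `x` the
limit of `(1/n) log ‖A^n(x)‖` exists and equals `L`. -/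
def IsUpperExponent (L : ℝ) : Prop :=
  ∀ᵐ x ∂μ, Tendsto (fun n : ℕ => 1 / (n : ℝ) * Real.log ‖toMap (iter T A n x)‖) atTop (𝓝 L)

/-- `L` is the lower Lyapunov exponent `λ⁻(A)` with respect to `μ`: for `μ`-almost every `x` the
limit of `(1/n) log (‖A^{-n}(x)‖⁻¹)` exists and equals `L`. -/
def IsLowerExponent (L : ℝ) : Prop :=
  ∀ᵐ x ∂μ, Tendsto (fun n : ℕ => 1 / (n : ℝ) * Real.log (‖toMap (iterNeg T A n x)‖⁻¹))
    atTop (𝓝 L)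

end Iterates

end LinearCocycle

end

/-! Let `f` and `e` be unit vectors spanning F and E, positively oriented. As `det A > 0`, A is
diagonal in this frame with entries `b = ‖A f‖` and `a = ‖A e‖` up to one common sign. The rotation
has diagonal entries `cos θ ± α sin θ`, where `α = -⟨f, e⟩ / cross f e` (the shear), and
off-diagonal entries `∓ sin θ / cross f e`. For small θ, after replacing `e` by `-e` if `sin θ < 0`,
a cone between `f` and `e` is mapped into itself. It contains an invariant direction `f + z e` with
`z ≥ 0`, along which the `f`-coordinate is multiplied, up to sign, by `b (cos θ + α sin θ) - r z`
with `r ≥ 0`.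

The Birkhoff average of the logarithm of this multiplier is the upper exponent. Dropping `r z` and
using `log (1 + t) ≤ t` gives `λ⁺(A_θ) ≤ λ⁺(A) + tan θ ∫ α + log (cos θ)`. On a side of 0 where `tan
θ ∫ α ≤ 0`, the term `log (cos θ) < 0` makes the drop strict. Since `det R_θ = 1`, the sum of the
two exponents does not depend on θ, so the lower exponent rises by the same amount.

The main ingredients are the pointwise ergodic theorem (`Ergodic.ae_tendsto_birkhoffSum`), a weight
that makes the domination visible in one step (`exists_adapted`), the invariant cones
(`exists_coneFrame`), the comparison of norms with Birkhoff sums (`ConeFrame.exists_const`) and the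
estimate `integral_logGrowth_lt`. -/

section Birkhoff

/-! ### The pointwise ergodic theorem -/

variable {α : Type*}

/-- The running maximum `max (0, S₁, …, Sₙ)` of the Birkhoff sums of `φ` along `f`. -/
def birkhoffMax (f : α → α) (φ : α → ℝ) : ℕ → α → ℝ
  | 0, _ => 0
  | n + 1, x => max 0 (φ x + birkhoffMax f φ n (f x))

theorem birkhoffMax_nonneg (f : α → α) (φ : α → ℝ) (n : ℕ) (x : α) : 0 ≤ birkhoffMax f φ n x := by
  cases n with
  | zero => exact le_rfl
  | succ n => exact le_max_left _ _

theorem birkhoffMax_le_succ (f : α → α) (φ : α → ℝ) (n : ℕ) (x : α) :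
    birkhoffMax f φ n x ≤ birkhoffMax f φ (n + 1) x := by
  induction n generalizing x with
  | zero => exact birkhoffMax_nonneg f φ 1 x
  | succ n ih => exact max_le_max le_rfl (add_le_add le_rfl (ih (f x)))

theorem birkhoffSum_le_birkhoffMax (f : α → α) (φ : α → ℝ) (n : ℕ) (x : α) :
    birkhoffSum f φ n x ≤ birkhoffMax f φ n x := by
  induction n generalizing x with
  | zero => simp [birkhoffMax]
  | succ n ih =>
    rw [birkhoffSum_succ']
    exact (add_le_add le_rfl (ih (f x))).trans (le_max_right _ _)

/-- The right side lies between `-|φ x|` and `|φ x|`, and equals `φ x` once the running maximum at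
`f x` is large. This feeds dominated convergence below. -/
theorem birkhoffMax_succ_sub (f : α → α) (φ : α → ℝ) (n : ℕ) (x : α) :
    birkhoffMax f φ (n + 1) x - birkhoffMax f φ n (f x) =
      max (-birkhoffMax f φ n (f x)) (φ x) := by
  rw [birkhoffMax, ← max_sub_sub_right]
  congr 1 <;> ring

variable [MeasurableSpace α] {μ : Measure α} {f : α → α} {φ : α → ℝ}

theorem measurable_birkhoffMax (hf : Measurable f) (hφ : Measurable φ) (n : ℕ) :
    Measurable (birkhoffMax f φ n) := by
  induction n with
  | zero => exact measurable_const
  | succ n ih => exact measurable_const.max (hφ.add (ih.comp hf))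

theorem integrable_birkhoffMax (hf : MeasurePreserving f μ μ) (hφ : Integrable φ μ) (n : ℕ) :
    Integrable (birkhoffMax f φ n) μ := by
  induction n with
  | zero => exact integrable_zero _ _ _
  | succ n ih =>
    exact (integrable_zero _ _ _).sup (hφ.add (hf.integrable_comp_of_integrable ih))

/-- The set `U` where the running maxima are unbounded is invariant, hence null or of full measure.
In the second case the differences `M (n + 1) - M n ∘ f` converge to `φ`, dominated by `|φ|`. Their
integrals are nonnegative because `M` increases with `n` and `f` preserves `μ`, contradicting `∫ φ <
0`. -/
theorem Ergodic.ae_bddAbove_birkhoffSum [IsProbabilityMeasure μ] (hf : Ergodic f μ)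
    (hφm : Measurable φ) (hφ : Integrable φ μ) (hneg : ∫ x, φ x ∂μ < 0) :
    ∀ᵐ x ∂μ, ∃ C : ℝ, ∀ n, birkhoffSum f φ n x ≤ C := by
  set M := birkhoffMax f φ with hM
  set U : Set α := {x | ∀ C : ℕ, ∃ n, (C : ℝ) < M n x} with hU
  have hMm : ∀ n, Measurable (M n) := measurable_birkhoffMax hf.measurable hφm
  have hMi : ∀ n, Integrable (M n) μ := integrable_birkhoffMax hf.toMeasurePreserving hφ
  have hUm : MeasurableSet U := by
    have : U = ⋂ C : ℕ, ⋃ n, {x | (C : ℝ) < M n x} := by ext; simp [hU]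
    rw [this]
    exact .iInter fun C => .iUnion fun n => measurableSet_lt measurable_const (hMm n)
  have hinv : f ⁻¹' U = U := by
    ext x
    constructor
    · intro h C
      obtain ⟨k, hk⟩ := exists_nat_ge (C - φ x)
      obtain ⟨n, hn⟩ := h k
      refine ⟨n + 1, lt_of_lt_of_le ?_ (le_max_right _ _)⟩
      change _ < φ x + M n (f x)
      linarith
    · intro h C
      obtain ⟨k, hk⟩ := exists_nat_ge (C + φ x)
      obtain ⟨n, hn⟩ := h k
      cases n with
      | zero => exact absurd hn (not_lt.2 (Nat.cast_nonneg k))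
      | succ n =>
        refine ⟨n, ?_⟩
        have h1 : (k : ℝ) < max 0 (φ x + M n (f x)) := hn
        rcases lt_max_iff.1 h1 with h2 | h2
        · exact absurd h2 (not_lt.2 (Nat.cast_nonneg k))
        · linarith
  rcases hf.toPreErgodic.ae_mem_or_ae_notMem hUm hinv with h | h
  · exfalso
    have hlim : Tendsto (fun n => ∫ x, (M (n + 1) x - M n (f x)) ∂μ) atTop (𝓝 (∫ x, φ x ∂μ)) := by
      refine tendsto_integral_of_dominated_convergence (fun x => |φ x|)
        (fun n => ((hMm (n + 1)).sub ((hMm n).comp hf.measurable)).aestronglyMeasurable)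
        hφ.abs (fun n => .of_forall fun x => ?_) ?_
      · have h0 := birkhoffMax_nonneg f φ n (f x)
        rw [birkhoffMax_succ_sub, Real.norm_eq_abs, abs_le]
        exact ⟨(neg_abs_le _).trans (le_max_right _ _),
          max_le (by have := abs_nonneg (φ x); linarith) (le_abs_self _)⟩
      · filter_upwards [h] with x hx
        have hfx : f x ∈ U := by rwa [← hinv] at hx
        obtain ⟨k, hk⟩ := exists_nat_ge (-φ x)
        obtain ⟨N, hN⟩ := hfx k
        refine tendsto_const_nhds.congr' ?_
        filter_upwards [eventually_ge_atTop N] with n hn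
        have h2 : M N (f x) ≤ M n (f x) :=
          monotone_nat_of_le_succ (f := fun n => M n (f x))
            (fun n => birkhoffMax_le_succ f φ n (f x)) hn
        rw [birkhoffMax_succ_sub, max_eq_right]
        change -M n (f x) ≤ _
        linarith
    have hge : ∀ n, 0 ≤ ∫ x, (M (n + 1) x - M n (f x)) ∂μ := by
      intro n
      have hcomp : ∫ x, M n (f x) ∂μ = ∫ x, M n x ∂μ := by
        conv_rhs => rw [← hf.map_eq]
        exact (integral_map hf.measurable.aemeasurable
          (hMm n).aestronglyMeasurable).symm
      have hci : Integrable (fun x => M n (f x)) μ :=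
        hf.toMeasurePreserving.integrable_comp_of_integrable (hMi n)
      rw [integral_sub (hMi _) hci, hcomp, sub_nonneg]
      exact integral_mono (hMi n) (hMi _) (birkhoffMax_le_succ f φ n)
    exact absurd (ge_of_tendsto' hlim hge) (not_le.2 hneg)
  · filter_upwards [h] with x hx
    simp only [hU, Set.mem_ofPred_eq, not_forall, not_exists, not_lt] at hx
    obtain ⟨C, hC⟩ := hx
    exact ⟨C, fun n => (birkhoffSum_le_birkhoffMax f φ n x).trans (hC n)⟩

/-- The pointwise ergodic theorem for an ergodic transformation. -/
theorem Ergodic.ae_tendsto_birkhoffSum [IsProbabilityMeasure μ] (hf : Ergodic f μ)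
    (hφm : Measurable φ) (hφ : Integrable φ μ) :
    ∀ᵐ x ∂μ, Tendsto (fun n : ℕ => 1 / (n : ℝ) * birkhoffSum f φ n x) atTop
      (𝓝 (∫ x, φ x ∂μ)) := by
  set c := ∫ x, φ x ∂μ with hc
  have hpos : ∀ k : ℕ, (0 : ℝ) < 1 / ((k : ℝ) + 1) := fun k => Nat.one_div_pos_of_nat
  have hconst : ∀ (d : ℝ) (n : ℕ) (x : α), birkhoffSum f (fun _ => d) n x = n * d := by
    intro d n x
    simp [birkhoffSum]
  -- Shifting `φ` by slightly more than its mean makes the integral negative, so the boundedness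
  -- result applies; `hlow` does the same for `-φ`. The margins `1 / (k + 1)` keep the exceptional
  -- sets countable in number.
  have hup : ∀ k : ℕ, ∀ᵐ x ∂μ, ∃ C : ℝ, ∀ n : ℕ,
      birkhoffSum f φ n x - n * c ≤ C + n * (1 / ((k : ℝ) + 1)) := by
    intro k
    have := hf.ae_bddAbove_birkhoffSum (φ := φ - fun _ => c + 1 / ((k : ℝ) + 1))
      (hφm.sub measurable_const) (hφ.sub (integrable_const _)) (by
        simp only [Pi.sub_apply]
        rw [integral_sub hφ (integrable_const _)]
        simpa [← hc] using inv_pos.1 (by simpa using hpos k))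
    filter_upwards [this] with x ⟨C, hC⟩
    refine ⟨C, fun n => ?_⟩
    have h1 := hC n
    rw [birkhoffSum_sub, hconst] at h1
    linarith
  have hlow : ∀ k : ℕ, ∀ᵐ x ∂μ, ∃ C : ℝ, ∀ n : ℕ,
      n * c - birkhoffSum f φ n x ≤ C + n * (1 / ((k : ℝ) + 1)) := by
    intro k
    have := hf.ae_bddAbove_birkhoffSum (φ := (fun _ => c - 1 / ((k : ℝ) + 1)) - φ)
      (measurable_const.sub hφm) ((integrable_const _).sub hφ) (by
        simp only [Pi.sub_apply]
        rw [integral_sub (integrable_const _) hφ]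
        simpa [← hc] using inv_pos.1 (by simpa using hpos k))
    filter_upwards [this] with x ⟨C, hC⟩
    refine ⟨C, fun n => ?_⟩
    have h1 := hC n
    rw [birkhoffSum_sub, hconst] at h1
    linarith
  filter_upwards [ae_all_iff.2 hup, ae_all_iff.2 hlow] with x h1 h2
  rw [Metric.tendsto_atTop]
  intro ε hε
  obtain ⟨k, hk⟩ := exists_nat_one_div_lt (half_pos hε)
  obtain ⟨C₁, hC₁⟩ := h1 k
  obtain ⟨C₂, hC₂⟩ := h2 k
  obtain ⟨N, hN⟩ := exists_nat_gt (max C₁ C₂ / (ε / 2))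
  refine ⟨N + 1, fun n hn => ?_⟩
  have hn1 : (N : ℝ) + 1 ≤ n := by exact_mod_cast hn
  have hn0 : (0 : ℝ) < n := by have := Nat.cast_nonneg (α := ℝ) N; linarith
  rw [div_lt_iff₀ (half_pos hε)] at hN
  have hb : max C₁ C₂ < n * (ε / 2) := hN.trans_le (by gcongr; linarith)
  have hb1 := (le_max_left C₁ C₂).trans_lt hb
  have hb2 := (le_max_right C₁ C₂).trans_lt hb
  have hk' : (n : ℝ) * (1 / ((k : ℝ) + 1)) ≤ n * (ε / 2) := by gcongr
  have e1 := hC₁ n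
  have e2 := hC₂ n
  have key : 1 / (n : ℝ) * birkhoffSum f φ n x - c = (birkhoffSum f φ n x - n * c) / n := by
    field_simp
  rw [Real.dist_eq, key, abs_div, abs_of_pos hn0, div_lt_iff₀ hn0, abs_lt]
  constructor <;> linarith

end Birkhoff

/-! ### Matrix norms, iterates, and exponents from Birkhoff sums -/

namespace LinearCocycle

theorem toMap_mul_apply (M N : GL (Fin 2) ℝ) (v : Plane) :
    toMap (M * N) v = toMap M (toMap N v) := by
  simp [toMap]

theorem toMap_one_apply (v : Plane) : toMap 1 v = v := by
  simp [toMap]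

theorem toMap_inv_apply_self (M : GL (Fin 2) ℝ) (v : Plane) : toMap M⁻¹ (toMap M v) = v := by
  rw [← toMap_mul_apply, inv_mul_cancel, toMap_one_apply]

theorem toMap_apply_ne_zero (M : GL (Fin 2) ℝ) {v : Plane} (hv : v ≠ 0) : toMap M v ≠ 0 := by
  intro h
  apply hv
  rw [← toMap_inv_apply_self M v, h, map_zero]

theorem toMap_ne_zero (M : GL (Fin 2) ℝ) : toMap M ≠ 0 := by
  intro h
  have hv : (EuclideanSpace.single 0 1 : Plane) ≠ 0 := by simp
  exact toMap_apply_ne_zero M hv (by rw [h]; rfl)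

theorem toMap_apply_zero (M : GL (Fin 2) ℝ) (v : Plane) :
    toMap M v 0 = M 0 0 * v 0 + M 0 1 * v 1 := by
  simp [toMap, Matrix.mulVec, dotProduct, Fin.sum_univ_two]

theorem toMap_apply_one (M : GL (Fin 2) ℝ) (v : Plane) :
    toMap M v 1 = M 1 0 * v 0 + M 1 1 * v 1 := by
  simp [toMap, Matrix.mulVec, dotProduct, Fin.sum_univ_two]

open scoped Matrix.Norms.L2Operator in
-- In dimension two the adjugate is the transpose conjugated by the quarter turn, so it has the same
-- norm as the matrix.
theorem norm_toMap_inv (M : GL (Fin 2) ℝ) :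
    ‖toMap M⁻¹‖ = |(M : Matrix (Fin 2) (Fin 2) ℝ).det|⁻¹ * ‖toMap M‖ := by
  set B : Matrix (Fin 2) (Fin 2) ℝ := M.val
  have hJ : (!![0, -1; 1, 0] : Matrix (Fin 2) (Fin 2) ℝ) ∈ unitary (Matrix (Fin 2) (Fin 2) ℝ) := by
    constructor <;> ext i j <;> fin_cases i <;> fin_cases j <;>
      simp [Matrix.star_eq_conjTranspose, Matrix.mul_apply, Fin.sum_univ_two]
  have hadj : B.adjugate = star !![0, -1; 1, 0] * (star B * !![0, -1; 1, 0]) := by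
    rw [Matrix.adjugate_fin_two]
    ext i j
    fin_cases i <;> fin_cases j <;>
      simp [Matrix.star_eq_conjTranspose, Matrix.mul_apply, Fin.sum_univ_two]
  change ‖((M⁻¹ : GL (Fin 2) ℝ) : Matrix (Fin 2) (Fin 2) ℝ)‖ = |B.det|⁻¹ * ‖B‖
  rw [Matrix.coe_units_inv, Matrix.inv_def, norm_smul, Ring.inverse_eq_inv', norm_inv,
    Real.norm_eq_abs, hadj]
  congr 1
  rw [CStarRing.norm_mem_unitary_mul _ (Unitary.star_mem hJ), CStarRing.norm_mul_mem_unitary _ hJ,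
    norm_star]

variable {X : Type*} [TopologicalSpace X] (T : X ≃ₜ X) (A : X → GL (Fin 2) ℝ)

theorem iter_succ' (n : ℕ) (x : X) : iter T A (n + 1) x = iter T A n (T x) * A x := by
  induction n generalizing x with
  | zero => simp [iter]
  | succ n ih =>
    rw [iter, ih, iter, mul_assoc, Function.iterate_succ_apply]

theorem iterNeg_eq_inv_iter (n : ℕ) (x : X) :
    iterNeg T A n x = (iter T A n (T.symm^[n] x))⁻¹ := by
  induction n generalizing x with
  | zero => simp [iter, iterNeg]
  | succ n ih =>
    rw [iterNeg, ih, iter_succ', mul_inv_rev, Function.iterate_succ_apply' _ n,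
      T.apply_symm_apply]

theorem log_abs_det_iter (n : ℕ) (x : X) :
    Real.log |(iter T A n x : Matrix (Fin 2) (Fin 2) ℝ).det| =
      birkhoffSum T (fun x => Real.log |(A x : Matrix (Fin 2) (Fin 2) ℝ).det|) n x := by
  have hne : ∀ M : GL (Fin 2) ℝ, |(M : Matrix (Fin 2) (Fin 2) ℝ).det| ≠ 0 := fun M =>
    abs_ne_zero.2 ((Matrix.isUnit_iff_isUnit_det _).1 M.isUnit).ne_zero
  induction n with
  | zero => simp [iter]
  | succ n ih =>
    rw [birkhoffSum_succ, ← ih, iter, Units.val_mul, Matrix.det_mul, abs_mul,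
      Real.log_mul (hne _) (hne _), add_comm]

theorem birkhoffSum_iterate_symm (ψ : X → ℝ) (n : ℕ) (x : X) :
    birkhoffSum T ψ n (T.symm^[n] x) = birkhoffSum T.symm (ψ ∘ T.symm) n x := by
  induction n generalizing x with
  | zero => simp
  | succ n ih =>
    rw [birkhoffSum_succ', birkhoffSum_succ, Function.iterate_succ_apply' _ n,
      T.apply_symm_apply, ih, add_comm]
    rfl

variable {T A} {φ : X → ℝ} {C : ℝ}

theorem abs_log_norm_iter_sub_le (hC : 0 < C)
    (h : ∀ n x, Real.exp (birkhoffSum T φ n x) ≤ C * ‖toMap (iter T A n x)‖ ∧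
      ‖toMap (iter T A n x)‖ ≤ C * Real.exp (birkhoffSum T φ n x)) (n : ℕ) (x : X) :
    |Real.log ‖toMap (iter T A n x)‖ - birkhoffSum T φ n x| ≤ Real.log C := by
  have hpos : 0 < ‖toMap (iter T A n x)‖ := norm_pos_iff.2 (toMap_ne_zero _)
  have h1 := Real.log_le_log (Real.exp_pos _) (h n x).1
  have h2 := Real.log_le_log hpos (h n x).2
  rw [Real.log_exp, Real.log_mul hC.ne' hpos.ne'] at h1
  rw [Real.log_mul hC.ne' (Real.exp_pos _).ne', Real.log_exp] at h2
  rw [abs_le]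
  constructor <;> linarith

theorem tendsto_of_abs_sub_le {u v : ℕ → ℝ} {c L : ℝ} (h : ∀ n, |u n - v n| ≤ c)
    (hv : Tendsto (fun n : ℕ => 1 / (n : ℝ) * v n) atTop (𝓝 L)) :
    Tendsto (fun n : ℕ => 1 / (n : ℝ) * u n) atTop (𝓝 L) := by
  have h0 : Tendsto (fun n : ℕ => 1 / (n : ℝ) * (u n - v n)) atTop (𝓝 0) := by
    refine squeeze_zero_norm (a := fun n : ℕ => 1 / (n : ℝ) * c) (fun n => ?_) ?_
    · rw [norm_mul, Real.norm_eq_abs, Real.norm_eq_abs, abs_of_nonneg (by positivity)]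
      gcongr
      exact h n
    · simpa using tendsto_one_div_atTop_nhds_zero_nat.mul_const c
  simpa [mul_sub] using h0.add hv

variable [MeasurableSpace X] {μ : Measure X} [IsProbabilityMeasure μ]

theorem isUpperExponent_of_birkhoffSum (hμ : Ergodic T μ) (hφm : Measurable φ)
    (hφ : Integrable φ μ) (hC : 0 < C)
    (h : ∀ n x, Real.exp (birkhoffSum T φ n x) ≤ C * ‖toMap (iter T A n x)‖ ∧
      ‖toMap (iter T A n x)‖ ≤ C * Real.exp (birkhoffSum T φ n x)) :
    IsUpperExponent T A μ (∫ x, φ x ∂μ) := by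
  filter_upwards [hμ.ae_tendsto_birkhoffSum hφm hφ] with x hx
  exact tendsto_of_abs_sub_le (fun n => abs_log_norm_iter_sub_le hC h n x) hx

/-- By `norm_toMap_inv`, `‖A^{-n}(x)‖⁻¹` is `|det A^n| / ‖A^n‖` taken at `T^{-n} x`. Its logarithm
is, up to a bounded error, a Birkhoff sum of `log |det A| - φ` along `T⁻¹`, which is ergodic too. -/
theorem isLowerExponent_of_birkhoffSum [BorelSpace X] (hμ : Ergodic T μ) (hφm : Measurable φ)
    (hφ : Integrable φ μ)
    (hdm : Measurable fun x => Real.log |(A x : Matrix (Fin 2) (Fin 2) ℝ).det|)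
    (hd : Integrable (fun x => Real.log |(A x : Matrix (Fin 2) (Fin 2) ℝ).det|) μ) (hC : 0 < C)
    (h : ∀ n x, Real.exp (birkhoffSum T φ n x) ≤ C * ‖toMap (iter T A n x)‖ ∧
      ‖toMap (iter T A n x)‖ ≤ C * Real.exp (birkhoffSum T φ n x)) :
    IsLowerExponent T A μ
      ((∫ x, Real.log |(A x : Matrix (Fin 2) (Fin 2) ℝ).det| ∂μ) - ∫ x, φ x ∂μ) := by
  set δ : X → ℝ := fun x => Real.log |(A x : Matrix (Fin 2) (Fin 2) ℝ).det| with hδ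
  have hs : Ergodic T.symm μ := Ergodic.symm (e := T.toMeasurableEquiv) hμ
  have hm : Measurable (T.symm : X → X) := T.symm.measurable
  have hψm : Measurable (δ - φ) := hdm.sub hφm
  have hψi : Integrable (δ - φ) μ := hd.sub hφ
  have hint : ∫ x, ((δ - φ) ∘ T.symm) x ∂μ = (∫ x, δ x ∂μ) - ∫ x, φ x ∂μ := by
    have h1 : ∫ x, ((δ - φ) ∘ T.symm) x ∂μ = ∫ x, (δ - φ) x ∂μ := by
      conv_rhs => rw [← hs.map_eq]
      exact (integral_map hm.aemeasurable hψm.aestronglyMeasurable).symm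
    rw [h1]
    exact integral_sub hd hφ
  filter_upwards [hs.ae_tendsto_birkhoffSum (hψm.comp hm)
    (hs.toMeasurePreserving.integrable_comp_of_integrable hψi)] with x hx
  rw [hint] at hx
  refine tendsto_of_abs_sub_le (c := Real.log C) (fun n => ?_) hx
  have hne : |(iter T A n (T.symm^[n] x) : Matrix (Fin 2) (Fin 2) ℝ).det| ≠ 0 :=
    abs_ne_zero.2 ((Matrix.isUnit_iff_isUnit_det _).1 (Units.isUnit _)).ne_zero
  have hne' : ‖toMap (iter T A n (T.symm^[n] x))‖ ≠ 0 := norm_ne_zero_iff.2 (toMap_ne_zero _)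
  rw [← birkhoffSum_iterate_symm, birkhoffSum_sub, ← log_abs_det_iter, iterNeg_eq_inv_iter,
    norm_toMap_inv, mul_inv, inv_inv, Real.log_mul hne (inv_ne_zero hne'), Real.log_inv, abs_sub_comm]
  convert abs_log_norm_iter_sub_le hC h n (T.symm^[n] x) using 2
  ring

/-! ### Invariant cones and the dominating direction -/

variable {X : Type*} [TopologicalSpace X] [MeasurableSpace X]

/-- A frame `(f, e)` of the plane in which the cocycle `M` has, up to sign, the matrix
`!![p, -r; q, t]` with nonnegative `q`, `r`, `t`, and preserves the cones
`{f + z e | 0 ≤ z ≤ k g}` for `k = 1, 2`. The constant `K` controls all the data. -/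
structure ConeFrame (T : X ≃ₜ X) (M : X → GL (Fin 2) ℝ) where
  f : X → Plane
  e : X → Plane
  sgn : X → ℝ
  p : X → ℝ
  q : X → ℝ
  r : X → ℝ
  t : X → ℝ
  g : X → ℝ
  K : ℝ
  measurable_p : Measurable p
  measurable_q : Measurable q
  measurable_r : Measurable r
  measurable_t : Measurable t
  abs_sgn : ∀ x, |sgn x| = 1
  map_f : ∀ x, toMap (M x) (f x) = sgn x • (p x • f (T x) + q x • e (T x))
  map_e : ∀ x, toMap (M x) (e x) = sgn x • (-r x • f (T x) + t x • e (T x))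
  q_nonneg : ∀ x, 0 ≤ q x
  r_nonneg : ∀ x, 0 ≤ r x
  t_nonneg : ∀ x, 0 ≤ t x
  K_pos : 0 < K
  le_g : ∀ x, K⁻¹ ≤ g x
  g_le : ∀ x, g x ≤ K
  p_le : ∀ x, p x ≤ K
  le_p : ∀ x, K⁻¹ ≤ p x - r x * (2 * g x)
  cone_one : ∀ x, q x + t x * g x ≤ g (T x) * (p x - r x * g x)
  cone_two : ∀ x, q x + t x * (2 * g x) ≤ 2 * g (T x) * (p x - r x * (2 * g x))
  norm_le : ∀ x a b, ‖a • f x + b • e x‖ ≤ K * (|a| + |b|)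
  abs_le : ∀ x a b, |a| ≤ K * ‖a • f x + b • e x‖ ∧ |b| ≤ K * ‖a • f x + b • e x‖
  span : ∀ x v, ∃ a b : ℝ, v = a • f x + b • e x

namespace ConeFrame

variable {T : X ≃ₜ X} {M : X → GL (Fin 2) ℝ} (c : ConeFrame T M)

/-- The action of the cocycle on slopes. -/
noncomputable def slope (x : X) (w : ℝ) : ℝ := (c.q x + c.t x * w) / (c.p x - c.r x * w)

theorem g_pos (x : X) : 0 < c.g x := (inv_pos.2 c.K_pos).trans_le (c.le_g x)

theorem inv_le_denom {x : X} {w : ℝ} (hw : w ≤ 2 * c.g x) : c.K⁻¹ ≤ c.p x - c.r x * w := by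
  have := mul_le_mul_of_nonneg_left hw (c.r_nonneg x)
  linarith [c.le_p x]

theorem denom_pos {x : X} {w : ℝ} (hw : w ≤ 2 * c.g x) : 0 < c.p x - c.r x * w :=
  (inv_pos.2 c.K_pos).trans_le (c.inv_le_denom hw)

theorem slope_nonneg {x : X} {w : ℝ} (h0 : 0 ≤ w) (hw : w ≤ 2 * c.g x) : 0 ≤ c.slope x w :=
  div_nonneg (add_nonneg (c.q_nonneg x) (mul_nonneg (c.t_nonneg x) h0)) (c.denom_pos hw).le

/-- Raising the slope raises the numerator and lowers the denominator, as `t` and `r` are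
nonnegative. -/
theorem slope_mono {x : X} {v w : ℝ} (h0 : 0 ≤ v) (hvw : v ≤ w) (hw : w ≤ 2 * c.g x) :
    c.slope x v ≤ c.slope x w := by
  have h1 := mul_le_mul_of_nonneg_left hvw (c.t_nonneg x)
  have h2 := mul_le_mul_of_nonneg_left hvw (c.r_nonneg x)
  exact div_le_div₀ (add_nonneg (c.q_nonneg x) (mul_nonneg (c.t_nonneg x) (h0.trans hvw)))
    (by linarith) (c.denom_pos hw) (by linarith)

theorem slope_le_one {x : X} {w : ℝ} (h0 : 0 ≤ w) (hw : w ≤ c.g x) : c.slope x w ≤ c.g (T x) := by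
  have hg := c.g_pos x
  refine (c.slope_mono h0 hw (by linarith)).trans ?_
  rw [slope, div_le_iff₀ (c.denom_pos (by linarith))]
  exact c.cone_one x

theorem slope_le_two {x : X} {w : ℝ} (h0 : 0 ≤ w) (hw : w ≤ 2 * c.g x) :
    c.slope x w ≤ 2 * c.g (T x) := by
  refine (c.slope_mono h0 hw le_rfl).trans ?_
  rw [slope, div_le_iff₀ (c.denom_pos le_rfl)]
  exact c.cone_two x

/-- The slopes of the images of `f` under `n` steps of the cocycle. -/
noncomputable def slopeIter : ℕ → X → ℝ
  | 0, _ => 0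
  | n + 1, x => c.slope (T.symm x) (slopeIter n (T.symm x))

theorem slopeIter_mem (n : ℕ) (x : X) : 0 ≤ c.slopeIter n x ∧ c.slopeIter n x ≤ c.g x := by
  induction n generalizing x with
  | zero => exact ⟨le_rfl, (c.g_pos x).le⟩
  | succ n ih =>
    obtain ⟨h0, h1⟩ := ih (T.symm x)
    refine ⟨c.slope_nonneg h0 (by linarith [c.g_pos (T.symm x)]), ?_⟩
    have := c.slope_le_one h0 h1
    rwa [T.apply_symm_apply] at this

theorem slopeIter_le_succ (n : ℕ) (x : X) : c.slopeIter n x ≤ c.slopeIter (n + 1) x := by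
  induction n generalizing x with
  | zero => exact (c.slopeIter_mem 1 x).1
  | succ n ih =>
    exact c.slope_mono (c.slopeIter_mem n _).1 (ih _)
      (by linarith [(c.slopeIter_mem (n + 1) (T.symm x)).2, c.g_pos (T.symm x)])

/-- The slope of the invariant dominating direction. -/
noncomputable def slopeLim (x : X) : ℝ := ⨆ n, c.slopeIter n x

theorem tendsto_slopeIter (x : X) :
    Tendsto (fun n => c.slopeIter n x) atTop (𝓝 (c.slopeLim x)) :=
  tendsto_atTop_ciSup (monotone_nat_of_le_succ fun n => c.slopeIter_le_succ n x)
    ⟨c.g x, by rintro _ ⟨n, rfl⟩; exact (c.slopeIter_mem n x).2⟩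

theorem slopeLim_nonneg (x : X) : 0 ≤ c.slopeLim x :=
  ge_of_tendsto' (c.tendsto_slopeIter x) fun n => (c.slopeIter_mem n x).1

theorem slopeLim_le (x : X) : c.slopeLim x ≤ c.g x :=
  le_of_tendsto' (c.tendsto_slopeIter x) fun n => (c.slopeIter_mem n x).2

theorem slopeLim_le_two (x : X) : c.slopeLim x ≤ 2 * c.g x := by
  linarith [c.slopeLim_le x, c.g_pos x]

/-- The slope map is continuous where its denominator is positive, so the limit of the increasing
slopes is invariant. -/
theorem slopeLim_apply (x : X) : c.slopeLim (T x) = c.slope x (c.slopeLim x) := by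
  refine tendsto_nhds_unique ((tendsto_add_atTop_iff_nat 1).2 (c.tendsto_slopeIter (T x))) ?_
  have h : ∀ n, c.slopeIter (n + 1) (T x) = c.slope x (c.slopeIter n x) := fun n => by
    rw [slopeIter, T.symm_apply_apply]
  simp only [h, slope]
  exact (((c.tendsto_slopeIter x).const_mul _).const_add _).div
    (((c.tendsto_slopeIter x).const_mul _).const_sub _) (c.denom_pos (c.slopeLim_le_two x)).ne'

theorem measurable_slopeLim [BorelSpace X] : Measurable c.slopeLim := by
  refine Measurable.iSup fun n => ?_
  induction n with
  | zero => exact measurable_const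
  | succ n ih =>
    have hT : Measurable (T.symm : X → X) := T.symm.measurable
    exact (((c.measurable_q.add (c.measurable_t.mul ih)).div
      (c.measurable_p.sub (c.measurable_r.mul ih))).comp hT :)

/-- The logarithmic growth of the `f`-coordinate along the invariant dominating direction. -/
noncomputable def logGrowth (x : X) : ℝ := Real.log (c.p x - c.r x * c.slopeLim x)

theorem exp_logGrowth (x : X) : Real.exp (c.logGrowth x) = c.p x - c.r x * c.slopeLim x :=
  Real.exp_log (c.denom_pos (c.slopeLim_le_two x))

theorem measurable_logGrowth [BorelSpace X] : Measurable c.logGrowth :=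
  (c.measurable_p.sub (c.measurable_r.mul c.measurable_slopeLim)).log

theorem integrable_logGrowth [BorelSpace X] (μ : Measure X) [IsFiniteMeasure μ] :
    Integrable c.logGrowth μ := by
  refine Integrable.of_bound c.measurable_logGrowth.aestronglyMeasurable (Real.log c.K)
    (.of_forall fun x => ?_)
  have h1 := Real.log_le_log (inv_pos.2 c.K_pos) (c.inv_le_denom (c.slopeLim_le_two x))
  have h2 := Real.log_le_log (c.denom_pos (c.slopeLim_le_two x))
    (y := c.K) (by linarith [mul_nonneg (c.r_nonneg x) (c.slopeLim_nonneg x), c.p_le x])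
  rw [Real.log_inv] at h1
  exact _root_.abs_le.2 ⟨h1, h2⟩

theorem map_cone (x : X) {w : ℝ} (hw : w ≤ 2 * c.g x) :
    toMap (M x) (c.f x + w • c.e x) =
      (c.sgn x * (c.p x - c.r x * w)) • (c.f (T x) + c.slope x w • c.e (T x)) := by
  have h : (c.p x - c.r x * w) * c.slope x w = c.q x + c.t x * w :=
    mul_div_cancel₀ _ (c.denom_pos hw).ne'
  rw [map_add, map_smul, c.map_f, c.map_e, smul_add ((c.sgn x * _)), smul_smul _ (c.slope x w),
    mul_assoc, h]
  module

theorem iter_slopeLim (n : ℕ) (x : X) : ∃ s : ℝ, |s| = 1 ∧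
    toMap (iter T M n x) (c.f x + c.slopeLim x • c.e x) =
      (s * Real.exp (birkhoffSum T c.logGrowth n x)) •
        (c.f (T^[n] x) + c.slopeLim (T^[n] x) • c.e (T^[n] x)) := by
  induction n with
  | zero => exact ⟨1, by simp, by simp [iter, toMap_one_apply]⟩
  | succ n ih =>
    obtain ⟨s, hs, h⟩ := ih
    refine ⟨s * c.sgn (T^[n] x), by rw [abs_mul, hs, c.abs_sgn, one_mul], ?_⟩
    rw [iter, toMap_mul_apply, h, map_smul, c.map_cone _ (c.slopeLim_le_two _),
      ← c.slopeLim_apply, birkhoffSum_succ, Real.exp_add, exp_logGrowth, smul_smul,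
      Function.iterate_succ_apply']
    congr 1
    ring

/-- A second vector, transversal to the invariant direction. Its slope stays above `slopeLim`, so
each of its multipliers `p - r y` is at most `p - r * slopeLim`: it grows no faster than the
invariant direction. -/
theorem iter_two_g (n : ℕ) (x : X) : ∃ s y : ℝ,
    |s| ≤ Real.exp (birkhoffSum T c.logGrowth n x) ∧
    c.slopeLim (T^[n] x) ≤ y ∧ y ≤ 2 * c.g (T^[n] x) ∧
    toMap (iter T M n x) (c.f x + (2 * c.g x) • c.e x) =
      s • (c.f (T^[n] x) + y • c.e (T^[n] x)) := by
  induction n with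
  | zero =>
    exact ⟨1, 2 * c.g x, by simp, c.slopeLim_le_two x, le_rfl, by simp [iter, toMap_one_apply]⟩
  | succ n ih =>
    obtain ⟨s, y, hs, hy, hy2, h⟩ := ih
    set x' := T^[n] x with hx'
    have h0 := c.slopeLim_nonneg x'
    refine ⟨s * (c.sgn x' * (c.p x' - c.r x' * y)), c.slope x' y, ?_, ?_, ?_, ?_⟩
    · rw [birkhoffSum_succ, Real.exp_add, exp_logGrowth, abs_mul, abs_mul, c.abs_sgn, one_mul,
        abs_of_pos (c.denom_pos hy2)]
      have := mul_le_mul_of_nonneg_left hy (c.r_nonneg x')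
      exact mul_le_mul hs (by linarith) (c.denom_pos hy2).le (Real.exp_pos _).le
    · rw [Function.iterate_succ_apply', c.slopeLim_apply]
      exact c.slope_mono h0 hy hy2
    · rw [Function.iterate_succ_apply']
      exact c.slope_le_two (h0.trans hy) hy2
    · rw [iter, toMap_mul_apply, h, map_smul, c.map_cone _ hy2, smul_smul,
        Function.iterate_succ_apply']

theorem norm_cone_le {x : X} {w : ℝ} (h0 : 0 ≤ w) (hw : w ≤ 2 * c.g x) :
    ‖c.f x + w • c.e x‖ ≤ c.K * (1 + 2 * c.K) := by
  have h := c.norm_le x 1 w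
  rw [one_smul, abs_one, abs_of_nonneg h0] at h
  exact h.trans (mul_le_mul_of_nonneg_left (by linarith [c.g_le x]) c.K_pos.le)

theorem exp_birkhoffSum_le (n : ℕ) (x : X) :
    Real.exp (birkhoffSum T c.logGrowth n x) ≤
      c.K * (c.K * (1 + 2 * c.K)) * ‖toMap (iter T M n x)‖ := by
  obtain ⟨s, hs, h⟩ := c.iter_slopeLim n x
  set P := Real.exp (birkhoffSum T c.logGrowth n x) with hP
  have hP0 : 0 < P := Real.exp_pos _
  have h1 := (c.abs_le (T^[n] x) (s * P) (s * P * c.slopeLim (T^[n] x))).1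
  rw [abs_mul, hs, one_mul, abs_of_pos hP0, mul_smul _ (c.slopeLim _), ← smul_add, ← h] at h1
  have h2 := (toMap (iter T M n x)).le_opNorm (c.f x + c.slopeLim x • c.e x)
  have h3 := c.norm_cone_le (c.slopeLim_nonneg x) (c.slopeLim_le_two x)
  calc P ≤ c.K * ‖toMap (iter T M n x) (c.f x + c.slopeLim x • c.e x)‖ := h1
    _ ≤ c.K * (‖toMap (iter T M n x)‖ * (c.K * (1 + 2 * c.K))) :=
        mul_le_mul_of_nonneg_left
          (h2.trans (mul_le_mul_of_nonneg_left h3 (norm_nonneg _))) c.K_pos.le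
    _ = _ := by ring

/-- The invariant vector and the edge of the outer cone form a basis whose slopes differ by at least
`K⁻¹`, since `slopeLim ≤ g`. The coordinates of a vector in it are therefore uniformly bounded, and
both basis vectors grow at most like the Birkhoff exponential. -/
theorem norm_iter_le (n : ℕ) (x : X) :
    ‖toMap (iter T M n x)‖ ≤
      (c.K + 2 * (c.K * (c.K + c.K * c.K))) * (c.K * (1 + 2 * c.K)) *
        Real.exp (birkhoffSum T c.logGrowth n x) := by
  have hK := c.K_pos
  set P := Real.exp (birkhoffSum T c.logGrowth n x) with hP
  have hP0 : 0 < P := Real.exp_pos _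
  refine ContinuousLinearMap.opNorm_le_bound _ (by positivity) fun v => ?_
  obtain ⟨a, b, hv⟩ := c.span x v
  obtain ⟨ha, hb⟩ := c.abs_le x a b
  rw [← hv] at ha hb
  set z := c.slopeLim x with hz
  have hz0 : 0 ≤ z := c.slopeLim_nonneg x
  have hzg : z ≤ c.g x := c.slopeLim_le x
  have hgK := c.le_g x
  have hgap : c.K⁻¹ ≤ 2 * c.g x - z := by linarith
  have hgap0 : 0 < 2 * c.g x - z := (inv_pos.2 hK).trans_le hgap
  set β := (b - a * z) / (2 * c.g x - z) with hβ
  have hβmul : β * (2 * c.g x - z) = b - a * z := div_mul_cancel₀ _ hgap0.ne'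
  have hdec : v = (a - β) • (c.f x + z • c.e x) + β • (c.f x + (2 * c.g x) • c.e x) := by
    have : b = (a - β) * z + β * (2 * c.g x) := by linarith
    rw [hv]
    conv_lhs => rw [this]
    module
  have hβabs : |β| ≤ c.K * (c.K + c.K * c.K) * ‖v‖ := by
    have h1 : |b - a * z| ≤ (c.K + c.K * c.K) * ‖v‖ := by
      have h2 : |a * z| ≤ c.K * ‖v‖ * c.K := by
        rw [abs_mul, abs_of_nonneg hz0]
        exact mul_le_mul ha (hzg.trans (c.g_le x)) hz0 (by positivity)
      have := abs_sub b (a * z)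
      linarith
    have h3 : |β| * c.K⁻¹ ≤ (c.K + c.K * c.K) * ‖v‖ := by
      refine le_trans ?_ h1
      rw [← hβmul, abs_mul, abs_of_pos hgap0]
      gcongr
    calc |β| = c.K * (|β| * c.K⁻¹) := by field_simp
      _ ≤ c.K * ((c.K + c.K * c.K) * ‖v‖) := by gcongr
      _ = _ := by ring
  have hαabs : |a - β| ≤ (c.K + c.K * (c.K + c.K * c.K)) * ‖v‖ := by
    have := abs_sub a β
    linarith
  obtain ⟨s, hs, h1⟩ := c.iter_slopeLim n x
  obtain ⟨s', y, hs', hy, hy2, h2⟩ := c.iter_two_g n x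
  have e1 : ‖toMap (iter T M n x) (c.f x + z • c.e x)‖ ≤ P * (c.K * (1 + 2 * c.K)) := by
    rw [h1, norm_smul, Real.norm_eq_abs, abs_mul, hs, one_mul, abs_of_pos hP0]
    exact mul_le_mul_of_nonneg_left
      (c.norm_cone_le (c.slopeLim_nonneg _) (c.slopeLim_le_two _)) hP0.le
  have e2 : ‖toMap (iter T M n x) (c.f x + (2 * c.g x) • c.e x)‖ ≤ P * (c.K * (1 + 2 * c.K)) := by
    rw [h2, norm_smul, Real.norm_eq_abs]
    exact mul_le_mul hs' (c.norm_cone_le ((c.slopeLim_nonneg _).trans hy) hy2) (norm_nonneg _)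
      hP0.le
  have e3 : ‖toMap (iter T M n x) v‖ ≤
      |a - β| * (P * (c.K * (1 + 2 * c.K))) + |β| * (P * (c.K * (1 + 2 * c.K))) := by
    rw [hdec, map_add, map_smul, map_smul]
    refine (norm_add_le _ _).trans ?_
    rw [norm_smul, norm_smul, Real.norm_eq_abs, Real.norm_eq_abs]
    gcongr
  calc ‖toMap (iter T M n x) v‖ ≤ (|a - β| + |β|) * (P * (c.K * (1 + 2 * c.K))) := by
        linarith
    _ ≤ ((c.K + c.K * (c.K + c.K * c.K)) * ‖v‖ + c.K * (c.K + c.K * c.K) * ‖v‖) *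
        (P * (c.K * (1 + 2 * c.K))) := by gcongr
    _ = _ := by ring

theorem exists_const : ∃ C : ℝ, 0 < C ∧ ∀ n x,
    Real.exp (birkhoffSum T c.logGrowth n x) ≤ C * ‖toMap (iter T M n x)‖ ∧
      ‖toMap (iter T M n x)‖ ≤ C * Real.exp (birkhoffSum T c.logGrowth n x) := by
  have hK := c.K_pos
  refine ⟨max (c.K * (c.K * (1 + 2 * c.K)))
    ((c.K + 2 * (c.K * (c.K + c.K * c.K))) * (c.K * (1 + 2 * c.K))),
    lt_max_of_lt_left (by positivity), fun n x => ⟨?_, ?_⟩⟩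
  · exact (c.exp_birkhoffSum_le n x).trans
      (mul_le_mul_of_nonneg_right (le_max_left _ _) (norm_nonneg _))
  · exact (c.norm_iter_le n x).trans
      (mul_le_mul_of_nonneg_right (le_max_right _ _) (Real.exp_pos _).le)

end ConeFrame

/-! ### Uniform decay of Birkhoff sums and adapted weights -/

section CompactDynamics

variable {X : Type*} [TopologicalSpace X]

theorem exists_abs_le_of_continuous [CompactSpace X] {φ : X → ℝ} (hφ : Continuous φ) : ∃ m, ∀ x, |φ x| ≤ m := by
  obtain ⟨m, hm⟩ := isCompact_univ.exists_bound_of_continuousOn hφ.continuousOn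
  exact ⟨m, fun x => hm x trivial⟩

theorem continuous_birkhoffSum {T : X → X} (hT : Continuous T) {ψ : X → ℝ} (hψ : Continuous ψ)
    (n : ℕ) : Continuous (birkhoffSum T ψ n) := by
  unfold birkhoffSum
  exact continuous_finsetSum _ fun k _ => hψ.comp (hT.iterate k)

/-- If at every point some Birkhoff sum of `ψ` drops below `-d < 0`, then the Birkhoff sums of `ψ`
decay linearly and uniformly. -/
theorem exists_birkhoffSum_le [CompactSpace X] {T : X → X} (hT : Continuous T) {ψ : X → ℝ} (hψ : Continuous ψ)
    {d : ℝ} (hd : 0 < d) (h : ∀ x, ∃ l : ℕ, 1 ≤ l ∧ birkhoffSum T ψ l x < -d) :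
    ∃ B κ : ℝ, 0 < κ ∧ ∀ n x, birkhoffSum T ψ n x ≤ B - n * κ := by
  choose l hl1 hl using h
  obtain ⟨t, -, ht⟩ := isCompact_univ.elim_nhds_subcover
    (fun x => {y | birkhoffSum T ψ (l x) y < -d})
    (fun x _ => ((continuous_birkhoffSum hT hψ (l x)).continuousAt).eventually_lt_const (hl x))
  -- By compactness finitely many of the times `l` serve all points, so every orbit splits into
  -- blocks of length at most `L`, each dropping the sum by `d`.
  set L : ℕ := t.sup l + 1 with hL
  have hL0 : (0 : ℝ) < L := by positivity
  obtain ⟨m, hm⟩ := exists_abs_le_of_continuous hψ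
  have hcover : ∀ x, ∃ j : ℕ, 1 ≤ j ∧ j ≤ L ∧ birkhoffSum T ψ j x < -d := by
    intro x
    obtain ⟨y, hy, hxy⟩ := Set.mem_iUnion₂.1 (ht (Set.mem_univ x))
    exact ⟨l y, hl1 y, (Finset.le_sup hy).trans (Nat.le_succ _), hxy⟩
  have hκ : (L : ℝ) * (d / L) = d := by field_simp
  -- The rate is `d` per block of length at most `L`. The constant pays for an incomplete last
  -- block: at most `L * |m|` for the sum and `d` for the unearned decay.
  refine ⟨L * |m| + d, d / L, by positivity, fun n => ?_⟩
  induction n using Nat.strong_induction_on with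
  | _ n ih =>
    intro x
    rcases lt_or_ge n L with hn | hn
    · have hn' : (n : ℝ) ≤ L := by exact_mod_cast hn.le
      have h1 : birkhoffSum T ψ n x ≤ n * |m| := by
        refine (Finset.sum_le_card_nsmul _ _ |m| fun k _ => ?_).trans_eq (by simp)
        exact (le_abs_self _).trans ((hm _).trans (le_abs_self m))
      have h2 : (n : ℝ) * |m| ≤ L * |m| := by gcongr
      have h3 : (n : ℝ) * (d / L) ≤ L * (d / L) := by gcongr
      linarith
    · obtain ⟨j, hj1, hjL, hj⟩ := hcover x
      have hjn : j + (n - j) = n := by omega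
      have h1 := ih (n - j) (by omega) (T^[j] x)
      have h2 := birkhoffSum_add T ψ j (n - j) x
      rw [hjn] at h2
      have h3 : ((n - j : ℕ) : ℝ) = n - j := Nat.cast_sub (hjL.trans hn)
      have h4 : (j : ℝ) * (d / L) ≤ L * (d / L) := by gcongr
      rw [h3, sub_mul] at h1
      linarith

/-- A cohomology argument: `ψ` is bounded above by a negative constant up to a continuous
coboundary. -/
theorem exists_adapted [CompactSpace X] {T : X → X} (hT : Continuous T) {ψ : X → ℝ} (hψ : Continuous ψ)
    {d : ℝ} (hd : 0 < d) (h : ∀ x, ∃ l : ℕ, 1 ≤ l ∧ birkhoffSum T ψ l x < -d) :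
    ∃ (u : X → ℝ) (κ : ℝ), Continuous u ∧ 0 < κ ∧ ∀ x, ψ x + u x ≤ u (T x) - κ := by
  obtain ⟨B, κ, hκ, hB⟩ := exists_birkhoffSum_le hT hψ hd h
  obtain ⟨N, hN⟩ := exists_nat_gt (|B| / (κ / 2))
  rw [div_lt_iff₀ (half_pos hκ)] at hN
  have hN0 : (0 : ℝ) < N := by
    by_contra hcon
    nlinarith [abs_nonneg B]
  -- With `u` minus the mean of the first `N` Birkhoff sums `S_j`, one has `ψ + u = u ∘ T + S_N /
  -- N`. The choice of `N` makes the last term at most `-κ / 2`.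
  refine ⟨fun x => -((N : ℝ)⁻¹ * ∑ j ∈ Finset.range N, birkhoffSum T ψ j x), κ / 2,
    (continuous_const.mul
      (continuous_finsetSum _ fun j _ => continuous_birkhoffSum hT hψ j)).neg,
    half_pos hκ, fun x => ?_⟩
  have h1 : ∑ j ∈ Finset.range N, birkhoffSum T ψ j (T x) =
      (∑ j ∈ Finset.range N, birkhoffSum T ψ j x) + birkhoffSum T ψ N x - N * ψ x := by
    have h2 : ∀ j, birkhoffSum T ψ j (T x) = birkhoffSum T ψ (j + 1) x - ψ x := fun j => by
      rw [birkhoffSum_succ']; ring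
    simp only [h2, Finset.sum_sub_distrib, Finset.sum_const, Finset.card_range, nsmul_eq_mul]
    have h3 := Finset.sum_range_succ' (fun j => birkhoffSum T ψ j x) N
    rw [Finset.sum_range_succ, birkhoffSum_zero, add_zero] at h3
    rw [← h3]
  have h4 : (N : ℝ)⁻¹ * birkhoffSum T ψ N x ≤ -(κ / 2) := by
    rw [inv_mul_le_iff₀ hN0]
    linarith [hB N x, le_abs_self B]
  beta_reduce
  rw [h1]
  have h5 : (N : ℝ)⁻¹ * (N * ψ x) = ψ x := by field_simp
  rw [mul_sub, mul_add, h5]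
  linarith

end CompactDynamics

/-! ### Rotations in an oblique frame -/

section PlaneGeometry

/-- The signed area of the parallelogram spanned by two vectors of the plane. -/
def cross (u v : Plane) : ℝ := u 0 * v 1 - u 1 * v 0

theorem cross_smul_left (k : ℝ) (u v : Plane) : cross (k • u) v = k * cross u v := by
  simp [cross]; ring

theorem cross_smul_right (k : ℝ) (u v : Plane) : cross u (k • v) = k * cross u v := by
  simp [cross]; ring

theorem cross_toMap (M : GL (Fin 2) ℝ) (u v : Plane) :
    cross (toMap M u) (toMap M v) = (M : Matrix (Fin 2) (Fin 2) ℝ).det * cross u v := by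
  simp only [cross, toMap_apply_zero, toMap_apply_one, Matrix.det_fin_two]
  ring

theorem inner_plane (u v : Plane) : inner ℝ u v = u 0 * v 0 + u 1 * v 1 := by
  simp [PiLp.inner_apply, Fin.sum_univ_two, mul_comm]

theorem abs_cross_le (u v : Plane) : |cross u v| ≤ ‖u‖ * ‖v‖ := by
  refine abs_le_of_sq_le_sq ?_ (by positivity)
  rw [mul_pow, ← real_inner_self_eq_norm_sq, ← real_inner_self_eq_norm_sq, inner_plane,
    inner_plane, cross]
  nlinarith [sq_nonneg (u 0 * v 0 + u 1 * v 1)]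

/-- Cramer's rule in the plane. -/
theorem cross_mul_smul (u v w : Plane) :
    cross u v • w = cross w v • u + cross u w • v := by
  ext i
  fin_cases i <;> simp [cross] <;> ring

/-- With `J` the quarter turn, `R_θ u = cos θ u + sin θ J u`, and `v = ⟨u, v⟩ u + cross u v J u` for
unit `u`; solve for `J u`. -/
theorem toMap_rotation_left (θ : ℝ) {u v : Plane} (hu : ‖u‖ = 1) (h : cross u v ≠ 0) :
    toMap (rotation θ) u =
      (Real.cos θ + -(inner ℝ u v / cross u v) * Real.sin θ) • u +
        (Real.sin θ / cross u v) • v := by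
  have hu' : u 0 * u 0 + u 1 * u 1 = 1 := by
    rw [← inner_plane, real_inner_self_eq_norm_sq, hu, one_pow]
  rw [inner_plane]
  ext i
  fin_cases i
  · simp only [Fin.zero_eta, toMap_apply_zero, PiLp.add_apply, PiLp.smul_apply, smul_eq_mul]
    field_simp
    simp [rotation, Matrix.GeneralLinearGroup.mkOfDetNeZero]
    simp only [cross]
    linear_combination (Real.sin θ * v 0) * hu'
  · simp only [Fin.mk_one, toMap_apply_one, PiLp.add_apply, PiLp.smul_apply, smul_eq_mul]
    field_simp
    simp [rotation, Matrix.GeneralLinearGroup.mkOfDetNeZero]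
    simp only [cross]
    linear_combination (Real.sin θ * v 1) * hu'

theorem toMap_rotation_right (θ : ℝ) {u v : Plane} (hv : ‖v‖ = 1) (h : cross u v ≠ 0) :
    toMap (rotation θ) v =
      (-(Real.sin θ / cross u v)) • u +
        (Real.cos θ - -(inner ℝ u v / cross u v) * Real.sin θ) • v := by
  have hv' : v 0 * v 0 + v 1 * v 1 = 1 := by
    rw [← inner_plane, real_inner_self_eq_norm_sq, hv, one_pow]
  rw [inner_plane]
  ext i
  fin_cases i
  · simp only [Fin.zero_eta, toMap_apply_zero, PiLp.add_apply, PiLp.smul_apply, smul_eq_mul]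
    field_simp
    simp [rotation, Matrix.GeneralLinearGroup.mkOfDetNeZero]
    simp only [cross]
    linear_combination (-Real.sin θ * u 0) * hv'
  · simp only [Fin.mk_one, toMap_apply_one, PiLp.add_apply, PiLp.smul_apply, smul_eq_mul]
    field_simp
    simp [rotation, Matrix.GeneralLinearGroup.mkOfDetNeZero]
    simp only [cross]
    linear_combination (-Real.sin θ * u 1) * hv'

theorem continuous_toMap : Continuous toMap := by
  have h : Continuous fun B : Matrix (Fin 2) (Fin 2) ℝ =>
      Matrix.toEuclideanCLM (n := Fin 2) (𝕜 := ℝ) B :=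
    LinearMap.continuous_of_finiteDimensional
      ((Matrix.toEuclideanCLM (n := Fin 2) (𝕜 := ℝ)).toAlgEquiv.toLinearMap)
  exact h.comp Units.continuous_val

end PlaneGeometry

/-! ### Continuity of quantities attached to line fields -/

section LineFields

variable {X : Type*} [TopologicalSpace X]

theorem IsContinuousLineField.exists_unit {E : X → Submodule ℝ Plane}
    (hE : IsContinuousLineField E) (x : X) : ∃ v : Plane, ‖v‖ = 1 ∧ E x = Submodule.span ℝ {v} := by
  obtain ⟨U, hU, u, -, hu⟩ := hE.2 x
  obtain ⟨h0, hspan⟩ := hu x (mem_of_mem_nhds hU)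
  refine ⟨‖u x‖⁻¹ • u x, norm_smul_inv_norm h0, ?_⟩
  rw [hspan, Submodule.span_singleton_smul_eq
    (isUnit_iff_ne_zero.2 (inv_ne_zero (norm_ne_zero_iff.2 h0)))]

theorem IsContinuousLineField.exists_local {E : X → Submodule ℝ Plane}
    (hE : IsContinuousLineField E) {e : X → Plane} (he : ∀ x, ‖e x‖ = 1)
    (hspan : ∀ x, E x = Submodule.span ℝ {e x}) (x₀ : X) :
    ∃ u : X → Plane, ContinuousAt u x₀ ∧
      ∀ᶠ x in 𝓝 x₀, u x ≠ 0 ∧ ∃ k : ℝ, |k| = ‖u x‖⁻¹ ∧ e x = k • u x := by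
  obtain ⟨U, hU, u, huc, hu⟩ := hE.2 x₀
  refine ⟨u, huc.continuousAt hU, ?_⟩
  filter_upwards [hU] with x hx
  obtain ⟨h0, h1⟩ := hu x hx
  have hmem : e x ∈ Submodule.span ℝ {u x} := by
    rw [← h1, hspan x]
    exact Submodule.mem_span_singleton_self _
  obtain ⟨k, hk⟩ := Submodule.mem_span_singleton.1 hmem
  refine ⟨h0, k, ?_, hk.symm⟩
  have h2 := he x
  rw [← hk, norm_smul, Real.norm_eq_abs] at h2
  exact eq_inv_of_mul_eq_one_left h2

/-- The unit vectors `e x` are chosen pointwise and may jump in sign. The norm ignores the sign, so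
it can be computed from a local continuous spanning field. -/
theorem continuous_norm_apply {E : X → Submodule ℝ Plane} (hE : IsContinuousLineField E)
    {e : X → Plane} (he : ∀ x, ‖e x‖ = 1) (hspan : ∀ x, E x = Submodule.span ℝ {e x})
    {B : X → Plane →L[ℝ] Plane} (hB : Continuous B) : Continuous fun x => ‖B x (e x)‖ := by
  refine continuous_iff_continuousAt.2 fun x₀ => ?_
  obtain ⟨u, hu, hloc⟩ := hE.exists_local he hspan x₀
  have h0 : u x₀ ≠ 0 := hloc.self_of_nhds.1
  have hc : ContinuousAt (fun x => ‖u x‖⁻¹ * ‖B x (u x)‖) x₀ :=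
    (hu.norm.inv₀ (norm_ne_zero_iff.2 h0)).mul (hB.continuousAt.clm_apply hu).norm
  refine hc.congr ?_
  filter_upwards [hloc] with x ⟨_, k, hk, hx⟩
  rw [hx, map_smul, norm_smul, Real.norm_eq_abs, hk]

theorem continuousAt_cross {u v : X → Plane} {x₀ : X} (hu : ContinuousAt u x₀)
    (hv : ContinuousAt v x₀) : ContinuousAt (fun x => cross (u x) (v x)) x₀ := by
  have h : ∀ {w : X → Plane} (i : Fin 2), ContinuousAt w x₀ → ContinuousAt (fun x => w x i) x₀ :=
    fun i hw => ((EuclideanSpace.proj i : Plane →L[ℝ] ℝ).continuous.continuousAt).comp hw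
  exact ((h 0 hu).mul (h 1 hv)).sub ((h 1 hu).mul (h 0 hv))

theorem continuous_cross_of_lineFields
    {E F : X → Submodule ℝ Plane} (hE : IsContinuousLineField E) (hF : IsContinuousLineField F)
    {e f : X → Plane} (he : ∀ x, ‖e x‖ = 1) (hf : ∀ x, ‖f x‖ = 1)
    (hEs : ∀ x, E x = Submodule.span ℝ {e x}) (hFs : ∀ x, F x = Submodule.span ℝ {f x})
    (hpos : ∀ x, 0 < cross (f x) (e x)) : Continuous fun x => cross (f x) (e x) := by
  refine continuous_iff_continuousAt.2 fun x₀ => ?_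
  obtain ⟨u, hu, hul⟩ := hE.exists_local he hEs x₀
  obtain ⟨v, hv, hvl⟩ := hF.exists_local hf hFs x₀
  have hc : ContinuousAt (fun x => ‖v x‖⁻¹ * (‖u x‖⁻¹ * |cross (v x) (u x)|)) x₀ :=
    (hv.norm.inv₀ (norm_ne_zero_iff.2 hvl.self_of_nhds.1)).mul
      ((hu.norm.inv₀ (norm_ne_zero_iff.2 hul.self_of_nhds.1)).mul (continuousAt_cross hv hu).abs)
  refine hc.congr ?_
  filter_upwards [hul, hvl] with x ⟨_, k, hk, hx⟩ ⟨_, k', hk', hx'⟩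
  rw [← abs_of_pos (hpos x), hx, hx', cross_smul_left, cross_smul_right, abs_mul, abs_mul, hk, hk']

/-- The quotient is homogeneous of degree zero in each vector, so any local spanning fields give the
same value. -/
theorem continuous_inner_div_cross
    {E F : X → Submodule ℝ Plane} (hE : IsContinuousLineField E) (hF : IsContinuousLineField F)
    {e f : X → Plane} (he : ∀ x, ‖e x‖ = 1) (hf : ∀ x, ‖f x‖ = 1)
    (hEs : ∀ x, E x = Submodule.span ℝ {e x}) (hFs : ∀ x, F x = Submodule.span ℝ {f x})
    (hpos : ∀ x, 0 < cross (f x) (e x)) :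
    Continuous fun x => inner ℝ (f x) (e x) / cross (f x) (e x) := by
  refine continuous_iff_continuousAt.2 fun x₀ => ?_
  obtain ⟨u, hu, hul⟩ := hE.exists_local he hEs x₀
  obtain ⟨v, hv, hvl⟩ := hF.exists_local hf hFs x₀
  have hne : ∀ᶠ x in 𝓝 x₀, cross (v x) (u x) ≠ 0 ∧
      inner ℝ (v x) (u x) / cross (v x) (u x) = inner ℝ (f x) (e x) / cross (f x) (e x) := by
    filter_upwards [hul, hvl] with x ⟨_, k, hk, hx⟩ ⟨_, k', hk', hx'⟩
    have h := (hpos x).ne'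
    rw [hx, hx', cross_smul_left, cross_smul_right] at h ⊢
    rw [real_inner_smul_left, real_inner_smul_right]
    have h1 := left_ne_zero_of_mul h
    have h2 := right_ne_zero_of_mul h
    refine ⟨right_ne_zero_of_mul h2, ?_⟩
    rw [mul_div_mul_left _ _ h1, mul_div_mul_left _ _ (left_ne_zero_of_mul h2)]
  have hc : ContinuousAt (fun x => inner ℝ (v x) (u x) / cross (v x) (u x)) x₀ :=
    (hv.inner hu).div (continuousAt_cross hv hu) hne.self_of_nhds.1
  exact hc.congr (hne.mono fun x hx => hx.2)

end LineFields

/-- A positively oriented frame of unit vectors adapted to the dominated splitting of `A`: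
`f` spans the dominating direction, `e` the dominated one, and the weight `g` makes the
domination visible in a single step. -/
structure AdaptedFrame {X : Type*} [TopologicalSpace X] (T : X ≃ₜ X)
    (A : X → GL (Fin 2) ℝ) where
  f : X → Plane
  e : X → Plane
  sgn : X → ℝ
  g : X → ℝ
  σ : ℝ
  norm_f : ∀ x, ‖f x‖ = 1
  norm_e : ∀ x, ‖e x‖ = 1
  cross_pos : ∀ x, 0 < cross (f x) (e x)
  abs_sgn : ∀ x, |sgn x| = 1
  map_f : ∀ x, toMap (A x) (f x) = sgn x • ‖toMap (A x) (f x)‖ • f (T x)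
  map_e : ∀ x, toMap (A x) (e x) = sgn x • ‖toMap (A x) (e x)‖ • e (T x)
  continuous_norm_f : Continuous fun x => ‖toMap (A x) (f x)‖
  continuous_norm_e : Continuous fun x => ‖toMap (A x) (e x)‖
  continuous_cross : Continuous fun x => cross (f x) (e x)
  continuous_inner_div_cross : Continuous fun x => inner ℝ (f x) (e x) / cross (f x) (e x)
  continuous_g : Continuous g
  g_pos : ∀ x, 0 < g x
  σ_nonneg : 0 ≤ σ
  σ_lt_one : σ < 1
  adapted : ∀ x, ‖toMap (A x) (e x)‖ * g x ≤ σ * (‖toMap (A x) (f x)‖ * g (T x))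

/-! ### From dominated splitting to an adapted frame -/

section Splitting

variable {X : Type*} [TopologicalSpace X] {T : X ≃ₜ X} {A : X → GL (Fin 2) ℝ}

theorem norm_toMap_iter {e : X → Plane} (he : ∀ x, ‖e x‖ = 1)
    (hmap : ∀ x, ∃ k : ℝ, toMap (A x) (e x) = k • e (T x)) (n : ℕ) (x : X) :
    (∃ k : ℝ, toMap (iter T A n x) (e x) = k • e (T^[n] x)) ∧
    ‖toMap (iter T A n x) (e x)‖ =
      Real.exp (birkhoffSum T (fun x => Real.log ‖toMap (A x) (e x)‖) n x) := by
  induction n with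
  | zero => exact ⟨⟨1, by simp [iter, toMap_one_apply]⟩, by simp [iter, toMap_one_apply, he]⟩
  | succ n ih =>
    obtain ⟨⟨k, hk⟩, hn⟩ := ih
    obtain ⟨k', hk'⟩ := hmap (T^[n] x)
    have hne : e (T^[n] x) ≠ 0 := norm_ne_zero_iff.1 (by rw [he]; exact one_ne_zero)
    have hpos : 0 < ‖toMap (A (T^[n] x)) (e (T^[n] x))‖ :=
      norm_pos_iff.2 (toMap_apply_ne_zero _ hne)
    refine ⟨⟨k * k', ?_⟩, ?_⟩
    · rw [iter, toMap_mul_apply, hk, map_smul, hk', smul_smul, Function.iterate_succ_apply']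
    · rw [iter, toMap_mul_apply, birkhoffSum_succ, Real.exp_add, ← hn, Real.exp_log hpos, hk,
        map_smul, norm_smul, norm_smul, he, mul_one]

/-- Along invariant lines norms multiply, so the two factors bound the exponentials of the sum of
`log ‖A e‖` and of minus the sum of `log ‖A f‖`. The bound `1/2` becomes `-log 2`. -/
theorem birkhoffSum_lt_of_domination {E F : X → Submodule ℝ Plane} {e f : X → Plane}
    (he : ∀ x, ‖e x‖ = 1) (hf : ∀ x, ‖f x‖ = 1) (heE : ∀ x, e x ∈ E x) (hfF : ∀ x, f x ∈ F x)
    (hmape : ∀ x, ∃ k : ℝ, toMap (A x) (e x) = k • e (T x))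
    (hmapf : ∀ x, ∃ k : ℝ, toMap (A x) (f x) = k • f (T x)) {l : ℕ} {x : X}
    (h : ‖(toMap (iter T A l x)).comp (E x).subtypeL‖ *
      ‖(toMap (iterNeg T A l (T^[l] x))).comp (F (T^[l] x)).subtypeL‖ < 1 / 2) :
    birkhoffSum T (fun x => Real.log ‖toMap (A x) (e x)‖ - Real.log ‖toMap (A x) (f x)‖) l x <
      -Real.log 2 := by
  obtain ⟨-, hen⟩ := norm_toMap_iter he hmape l x
  obtain ⟨⟨k, hk⟩, hfn⟩ := norm_toMap_iter hf hmapf l x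
  set a := birkhoffSum T (fun x => Real.log ‖toMap (A x) (e x)‖) l x
  set b := birkhoffSum T (fun x => Real.log ‖toMap (A x) (f x)‖) l x
  have h1 : Real.exp a ≤ ‖(toMap (iter T A l x)).comp (E x).subtypeL‖ := by
    have := ((toMap (iter T A l x)).comp (E x).subtypeL).le_opNorm ⟨e x, heE x⟩
    rw [← hen]
    simpa [he] using this
  have hsymm : T.symm^[l] (T^[l] x) = x :=
    (Function.LeftInverse.iterate T.symm_apply_apply l) x
  have hkabs : |k| = Real.exp b := by
    rw [← hfn, hk, norm_smul, hf, mul_one, Real.norm_eq_abs]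
  have hk0 : k ≠ 0 := abs_ne_zero.1 (by rw [hkabs]; exact (Real.exp_pos b).ne')
  have h2 : Real.exp (-b) ≤ ‖(toMap (iterNeg T A l (T^[l] x))).comp (F (T^[l] x)).subtypeL‖ := by
    have h3 := ((toMap (iterNeg T A l (T^[l] x))).comp (F (T^[l] x)).subtypeL).le_opNorm
      ⟨f (T^[l] x), hfF _⟩
    have h4 : toMap (iterNeg T A l (T^[l] x)) (f (T^[l] x)) = k⁻¹ • f x := by
      rw [iterNeg_eq_inv_iter, hsymm, ← toMap_inv_apply_self (iter T A l x) (f x), hk, map_smul,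
        smul_smul, inv_mul_cancel₀ hk0, one_smul]
    have h5 : ‖toMap (iterNeg T A l (T^[l] x)) (f (T^[l] x))‖ = Real.exp (-b) := by
      rw [h4, norm_smul, hf, mul_one, norm_inv, Real.norm_eq_abs, hkabs, Real.exp_neg]
    rw [← h5]
    simpa [hf] using h3
  have h3 : Real.exp (a - b) < Real.exp (-Real.log 2) := by
    rw [sub_eq_add_neg, Real.exp_add, Real.exp_neg (Real.log 2), Real.exp_log two_pos]
    refine (mul_le_mul h1 h2 (Real.exp_pos _).le
      ((Real.exp_pos _).le.trans h1)).trans_lt ?_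
    simpa using h
  have h4 := Real.exp_lt_exp.1 h3
  have h5 := birkhoffSum_sub T (fun x => Real.log ‖toMap (A x) (e x)‖)
    (fun x => Real.log ‖toMap (A x) (f x)‖) l x
  exact h5.trans_lt h4

theorem exists_smul_of_map_eq {E : X → Submodule ℝ Plane} {e : X → Plane}
    (hEs : ∀ x, E x = Submodule.span ℝ {e x})
    (hmap : ∀ x, (E x).map (toMap (A x)).toLinearMap = E (T x)) (x : X) :
    ∃ k : ℝ, toMap (A x) (e x) = k • e (T x) := by
  have h : toMap (A x) (e x) ∈ E (T x) := by
    rw [← hmap x]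
    exact Submodule.mem_map_of_mem (by rw [hEs]; exact Submodule.mem_span_singleton_self _)
  rw [hEs] at h
  obtain ⟨k, hk⟩ := Submodule.mem_span_singleton.1 h
  exact ⟨k, hk.symm⟩

theorem cross_ne_zero_of_isCompl {E F : Submodule ℝ Plane} (h : IsCompl E F) {u v : Plane}
    (hu : u ≠ 0) (hv : v ≠ 0) (hE : E = Submodule.span ℝ {u}) (hF : F = Submodule.span ℝ {v}) :
    cross v u ≠ 0 := by
  intro h0
  have h1 : ∀ w, cross w u • v = -(cross v w • u) := fun w => by
    have := cross_mul_smul v u w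
    rw [h0, zero_smul] at this
    exact eq_neg_of_add_eq_zero_left this.symm
  have h2 : ∀ w, cross w u = 0 := fun w => by
    have hvE : cross w u • v ∈ E := by
      rw [h1, hE]
      exact Submodule.neg_mem _ (Submodule.smul_mem _ _ (Submodule.mem_span_singleton_self _))
    have hvF : cross w u • v ∈ F := by
      rw [hF]
      exact Submodule.smul_mem _ _ (Submodule.mem_span_singleton_self _)
    exact (smul_eq_zero.1 (Submodule.disjoint_def.1 h.disjoint _ hvE hvF)).resolve_right hv
  apply hu
  ext i
  fin_cases i
  · simpa [cross] using h2 (EuclideanSpace.single 1 1)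
  · simpa [cross] using h2 (EuclideanSpace.single 0 1)

theorem exists_adaptedFrame [CompactSpace X] (hA : Continuous A)
    (hdet : ∀ x, 0 < (A x : Matrix (Fin 2) (Fin 2) ℝ).det) (hdom : HasDominatedSplitting T A) :
    Nonempty (AdaptedFrame T A) := by
  obtain ⟨E, F, hE, hF, hcompl, hmapE, hmapF, hl⟩ := hdom
  choose f hf hFs using hF.exists_unit
  choose e₀ he₀ hEs₀ using hE.exists_unit
  have hne : ∀ (v : X → Plane), (∀ x, ‖v x‖ = 1) → ∀ x, v x ≠ 0 := fun v hv x =>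
    norm_ne_zero_iff.1 (by rw [hv]; exact one_ne_zero)
  have hcr : ∀ x, cross (f x) (e₀ x) ≠ 0 := fun x =>
    cross_ne_zero_of_isCompl (hcompl x) (hne _ he₀ x) (hne _ hf x) (hEs₀ x) (hFs x)
  -- The sign of `e x` is chosen to orient the frame positively.
  have hex : ∀ x, ∃ v : Plane, ‖v‖ = 1 ∧ E x = Submodule.span ℝ {v} ∧ 0 < cross (f x) v := by
    intro x
    rcases lt_or_gt_of_ne (hcr x) with h | h
    · refine ⟨(-1 : ℝ) • e₀ x, by rw [norm_smul, he₀]; simp, ?_, ?_⟩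
      · rw [hEs₀ x, Submodule.span_singleton_smul_eq (isUnit_iff_ne_zero.2 (by norm_num))]
      · rw [cross_smul_right]; linarith
    · exact ⟨e₀ x, he₀ x, hEs₀ x, h⟩
  choose e he hEs hpos using hex
  have hmape := exists_smul_of_map_eq hEs hmapE
  have hmapf := exists_smul_of_map_eq hFs hmapF
  have heE : ∀ x, e x ∈ E x := fun x => by
    rw [hEs]; exact Submodule.mem_span_singleton_self _
  have hfF : ∀ x, f x ∈ F x := fun x => by
    rw [hFs]; exact Submodule.mem_span_singleton_self _
  have hAc : Continuous fun x => toMap (A x) := continuous_toMap.comp hA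
  have hcf := continuous_norm_apply hF hf hFs hAc
  have hce := continuous_norm_apply hE he hEs hAc
  have hfpos : ∀ x, 0 < ‖toMap (A x) (f x)‖ := fun x =>
    norm_pos_iff.2 (toMap_apply_ne_zero _ (hne f hf x))
  have hepos : ∀ x, 0 < ‖toMap (A x) (e x)‖ := fun x =>
    norm_pos_iff.2 (toMap_apply_ne_zero _ (hne e he x))
  obtain ⟨u, κ, hu, hκ, hadapt⟩ := exists_adapted T.continuous
    ((hce.log fun x => (hepos x).ne').sub (hcf.log fun x => (hfpos x).ne'))
    (Real.log_pos one_lt_two) (fun x => by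
      obtain ⟨l, hl1, h⟩ := hl x
      exact ⟨l, hl1, birkhoffSum_lt_of_domination he hf heE hfF hmape hmapf h⟩)
  choose a ha using hmape
  choose b hb using hmapf
  have ha' : ∀ x, |a x| = ‖toMap (A x) (e x)‖ := fun x => by
    rw [ha, norm_smul, he, mul_one, Real.norm_eq_abs]
  have hb' : ∀ x, |b x| = ‖toMap (A x) (f x)‖ := fun x => by
    rw [hb, norm_smul, hf, mul_one, Real.norm_eq_abs]
  -- A positive determinant preserves orientation and the frames at `x` and `T x` are both positive,
  -- so the two multipliers share a sign and one `sgn` serves both.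
  have hab : ∀ x, 0 < a x * b x := fun x => by
    have h := cross_toMap (A x) (f x) (e x)
    rw [ha, hb, cross_smul_left, cross_smul_right, ← mul_assoc] at h
    have h1 := mul_pos (hdet x) (hpos x)
    rw [← h] at h1
    rw [mul_comm]
    exact pos_of_mul_pos_left h1 (hpos _).le
  have hb0 : ∀ x, b x ≠ 0 := fun x => right_ne_zero_of_mul (hab x).ne'
  refine ⟨⟨f, e, fun x => b x / |b x|, fun x => Real.exp (u x), Real.exp (-κ), hf, he, hpos,
    fun x => ?_, fun x => ?_, fun x => ?_, hcf, hce,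
    continuous_cross_of_lineFields hE hF he hf hEs hFs hpos,
    continuous_inner_div_cross hE hF he hf hEs hFs hpos, hu.rexp, fun x => Real.exp_pos _,
    (Real.exp_pos _).le, Real.exp_lt_one_iff.2 (by linarith), fun x => ?_⟩⟩
  · rw [abs_div, abs_abs, div_self (abs_ne_zero.2 (hb0 x))]
  · rw [← hb', smul_smul, div_mul_cancel₀ _ (abs_ne_zero.2 (hb0 x)), hb]
  · rw [← ha', smul_smul, ha]
    congr 1
    rcases pos_and_pos_or_neg_and_neg_of_mul_pos (hab x) with ⟨h1, h2⟩ | ⟨h1, h2⟩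
    · rw [abs_of_pos h1, abs_of_pos h2, div_self h2.ne', one_mul]
    · rw [abs_of_neg h1, abs_of_neg h2, div_neg, div_self h2.ne]; ring
  · have h := Real.exp_le_exp.2 (hadapt x)
    rw [Pi.sub_apply, Real.exp_add, Real.exp_sub, Real.exp_sub, Real.exp_log (hepos x), Real.exp_log (hfpos x),
      div_mul_eq_mul_div, div_le_iff₀ (hfpos x)] at h
    rw [Real.exp_neg]
    calc _ ≤ _ := h
      _ = _ := by rw [div_eq_mul_inv]; ring

end Splitting

/-! ### Numerical estimates for the cones -/

section Inequalities

variable {a b g g' α β m η co si S : ℝ}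

/-- The perturbation of `co ≥ 1/2` is at most `m η + 2 m² η ≤ 3 m² η ≤ 1/4`, which explains the
factor 12. -/
theorem inv_le_cone_denom (hm : 1 ≤ m) (hb : m⁻¹ ≤ b) (hg0 : 0 ≤ g) (hg : g ≤ m) (hα : |α| ≤ m)
    (hβ0 : 0 ≤ β) (hβ : β ≤ m) (hco : 1 / 2 ≤ co) (hsi : |si| ≤ η) (hS0 : 0 ≤ S) (hS : S ≤ η)
    (hη : 12 * (m * m * η) ≤ 1) :
    (4 * m)⁻¹ ≤ b * (co + α * si) - b * S * β * (2 * g) := by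
  have hm0 : 0 < m := by linarith
  have hη0 : 0 ≤ η := hS0.trans hS
  have h1 : |α * si| ≤ m * η := by
    rw [abs_mul]; exact mul_le_mul hα hsi (abs_nonneg _) hm0.le
  have h2 : S * β * (2 * g) ≤ η * m * (2 * m) :=
    mul_le_mul (mul_le_mul hS hβ hβ0 hη0) (by linarith) (by positivity) (by positivity)
  have h3 : m * η ≤ m * m * η := by
    have := mul_le_mul_of_nonneg_right hm (mul_nonneg hm0.le hη0)
    linarith
  have h4 : 1 / 4 ≤ co + α * si - S * β * (2 * g) := by
    have := (abs_le.1 h1).1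
    linarith
  calc (4 * m)⁻¹ = m⁻¹ * (1 / 4) := by rw [mul_inv]; ring
    _ ≤ b * (co + α * si - S * β * (2 * g)) :=
      mul_le_mul hb h4 (by norm_num) ((inv_pos.2 hm0).le.trans hb)
    _ = _ := by ring

/-- Without rotation terms the inequality holds with slack `(1 - σ) k co b g' ≥ (1 - σ) / (2 m²)`,
at least `9 m⁴ η` by `hη`. The four terms containing `S` or `si` cost at most `(1 + 2 + 2 + 4) m⁴
η`. -/
theorem cone_invariance {σ k : ℝ} (hm : 1 ≤ m) (ha0 : 0 ≤ a) (ha : a ≤ m) (hb : m⁻¹ ≤ b)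
    (hb' : b ≤ m) (hg0 : 0 ≤ g) (hg : g ≤ m) (hg'0 : m⁻¹ ≤ g') (hg' : g' ≤ m) (hα : |α| ≤ m)
    (hβ0 : 0 ≤ β) (hβ : β ≤ m) (hco : 1 / 2 ≤ co) (hsi : |si| ≤ η) (hS0 : 0 ≤ S) (hS : S ≤ η)
    (hσ : σ ≤ 1) (hη : 18 * (m ^ 6 * η) ≤ 1 - σ) (hk1 : 1 ≤ k) (hk2 : k ≤ 2)
    (hadapt : a * g ≤ σ * (b * g')) :
    a * S * β + a * (co - α * si) * (k * g) ≤
      k * g' * (b * (co + α * si) - b * S * β * (k * g)) := by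
  have hm0 : 0 < m := by linarith
  have hη0 : 0 ≤ η := hS0.trans hS
  have hb0 : 0 ≤ b := (inv_pos.2 hm0).le.trans hb
  have hg'1 : 0 ≤ g' := (inv_pos.2 hm0).le.trans hg'0
  have hk0 : 0 ≤ k := by linarith
  have hkg : k * g ≤ 2 * m := mul_le_mul hk2 hg hg0 two_pos.le
  have hkg' : k * g' ≤ 2 * m := mul_le_mul hk2 hg' hg'1 two_pos.le
  have hkg0 : 0 ≤ k * g := mul_nonneg hk0 hg0
  have hkg'0 : 0 ≤ k * g' := mul_nonneg hk0 hg'1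
  have h1 : |α * si| ≤ m * η := by
    rw [abs_mul]; exact mul_le_mul hα hsi (abs_nonneg _) hm0.le
  have e1 : a * S * β ≤ m * η * m := mul_le_mul (mul_le_mul ha hS hS0 hm0.le) hβ hβ0 (by positivity)
  have e2 : a * (k * g) * -(α * si) ≤ m * (2 * m) * (m * η) :=
    (mul_le_mul_of_nonneg_left (neg_le.1 (abs_le.1 h1).1) (by positivity)).trans
      (mul_le_mul_of_nonneg_right (mul_le_mul ha hkg hkg0 hm0.le) (by positivity))
  have e3 : k * g' * b * -(α * si) ≤ 2 * m * m * (m * η) :=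
    (mul_le_mul_of_nonneg_left (neg_le.1 (abs_le.1 h1).1) (by positivity)).trans
      (mul_le_mul_of_nonneg_right (mul_le_mul hkg' hb' hb0 (by positivity)) (by positivity))
  have e4 : k * g' * (b * S * β * (k * g)) ≤ 2 * m * (m * η * m * (2 * m)) :=
    mul_le_mul hkg' (mul_le_mul (mul_le_mul (mul_le_mul hb' hS hS0 hm0.le) hβ hβ0 (by positivity))
      hkg hkg0 (by positivity)) (by positivity) (by positivity)
  have e5 : k * co * (a * g) ≤ k * co * (σ * (b * g')) :=
    mul_le_mul_of_nonneg_left hadapt (by positivity)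
  have e6 : 1 * (1 / 2) * (m⁻¹ * m⁻¹) ≤ k * co * (b * g') := by
    gcongr
  have e7 : (1 - σ) * (1 * (1 / 2) * (m⁻¹ * m⁻¹)) ≤ (1 - σ) * (k * co * (b * g')) :=
    mul_le_mul_of_nonneg_left e6 (by linarith)
  have e8 : 18 * (m ^ 6 * η) * (1 * (1 / 2) * (m⁻¹ * m⁻¹)) ≤
      (1 - σ) * (1 * (1 / 2) * (m⁻¹ * m⁻¹)) :=
    mul_le_mul_of_nonneg_right hη (by positivity)
  have e9 : 18 * (m ^ 6 * η) * (1 * (1 / 2) * (m⁻¹ * m⁻¹)) = 9 * (m ^ 4 * η) := by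
    field_simp
    ring
  have p2 : m ^ 2 * η ≤ m ^ 4 * η :=
    mul_le_mul_of_nonneg_right (pow_le_pow_right₀ hm (by norm_num)) hη0
  have p3 : m ^ 3 * η ≤ m ^ 4 * η :=
    mul_le_mul_of_nonneg_right (pow_le_pow_right₀ hm (by norm_num)) hη0
  nlinarith

end Inequalities

/-! ### Cones for the rotated cocycle -/

section Rotation

variable {X : Type*} [TopologicalSpace X] {T : X ≃ₜ X} {A : X → GL (Fin 2) ℝ}

namespace AdaptedFrame

variable (c : AdaptedFrame T A)

/-- The growth rate of `A` along the dominating direction. -/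
noncomputable def growth (x : X) : ℝ := ‖toMap (A x) (c.f x)‖

/-- The diagonal coefficient of the infinitesimal rotation in the frame. -/
noncomputable def shear (x : X) : ℝ := -(inner ℝ (c.f x) (c.e x) / cross (c.f x) (c.e x))

theorem growth_pos (x : X) : 0 < c.growth x :=
  norm_pos_iff.2 (toMap_apply_ne_zero _ (norm_ne_zero_iff.1 (by rw [c.norm_f]; exact one_ne_zero)))

theorem exists_bound [CompactSpace X] : ∃ m : ℝ, 1 ≤ m ∧ ∀ x, ‖toMap (A x) (c.e x)‖ ≤ m ∧
    m⁻¹ ≤ c.growth x ∧ c.growth x ≤ m ∧ m⁻¹ ≤ c.g x ∧ c.g x ≤ m ∧ |c.shear x| ≤ m ∧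
    (cross (c.f x) (c.e x))⁻¹ ≤ m := by
  have hgr : Continuous c.growth := c.continuous_norm_f
  obtain ⟨m₁, h₁⟩ := exists_abs_le_of_continuous c.continuous_norm_e
  obtain ⟨m₂, h₂⟩ := exists_abs_le_of_continuous hgr
  obtain ⟨m₃, h₃⟩ := exists_abs_le_of_continuous (hgr.inv₀ fun x => (c.growth_pos x).ne')
  obtain ⟨m₄, h₄⟩ := exists_abs_le_of_continuous c.continuous_g
  obtain ⟨m₅, h₅⟩ := exists_abs_le_of_continuous (c.continuous_g.inv₀ fun x => (c.g_pos x).ne')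
  obtain ⟨m₆, h₆⟩ := exists_abs_le_of_continuous c.continuous_inner_div_cross
  obtain ⟨m₇, h₇⟩ := exists_abs_le_of_continuous
    (c.continuous_cross.inv₀ fun x => (c.cross_pos x).ne')
  set m := 1 + |m₁| + |m₂| + |m₃| + |m₄| + |m₅| + |m₆| + |m₇| with hm
  have hm1 : 1 ≤ m := by
    linarith [abs_nonneg m₁, abs_nonneg m₂, abs_nonneg m₃, abs_nonneg m₄, abs_nonneg m₅,
      abs_nonneg m₆, abs_nonneg m₇]
  have key : ∀ {t b : ℝ}, |t| ≤ b → |b| ≤ m → t ≤ m := fun h h' =>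
    (le_abs_self _).trans (h.trans ((le_abs_self _).trans h'))
  have hle : |m₁| ≤ m ∧ |m₂| ≤ m ∧ |m₃| ≤ m ∧ |m₄| ≤ m ∧ |m₅| ≤ m ∧ |m₆| ≤ m ∧ |m₇| ≤ m := by
    refine ⟨?_, ?_, ?_, ?_, ?_, ?_, ?_⟩ <;>
    linarith [abs_nonneg m₁, abs_nonneg m₂, abs_nonneg m₃, abs_nonneg m₄, abs_nonneg m₅,
      abs_nonneg m₆, abs_nonneg m₇]
  obtain ⟨l₁, l₂, l₃, l₄, l₅, l₆, l₇⟩ := hle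
  refine ⟨m, hm1, fun x => ⟨key (h₁ x) l₁, ?_, key (h₂ x) l₂, ?_, key (h₄ x) l₄, ?_,
    key (h₇ x) l₇⟩⟩
  · exact inv_le_of_inv_le₀ (c.growth_pos x) (key (h₃ x) l₃)
  · exact inv_le_of_inv_le₀ (c.g_pos x) (key (h₅ x) l₅)
  · rw [shear, abs_neg]
    exact (h₆ x).trans ((le_abs_self _).trans l₆)

variable [CompactSpace X] [MeasurableSpace X] [BorelSpace X]

/-- For small rotations, turning towards the side `s = ±1`, the rotated cocycle has an invariant
cone family between the dominating direction and `s` times the dominated one. -/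
theorem exists_coneFrame : ∃ δ : ℝ, 0 < δ ∧ δ ≤ 1 ∧ ∀ s θ : ℝ, |s| = 1 → |θ| < δ →
    0 ≤ s * Real.sin θ → ∃ d : ConeFrame T (rotate A θ), ∀ x,
      d.p x = c.growth x * (Real.cos θ + c.shear x * Real.sin θ) ∧
      d.r x = c.growth x * (s * Real.sin θ) * (cross (c.f x) (c.e x))⁻¹ := by
  obtain ⟨m, hm, hb⟩ := c.exists_bound
  have hm0 : 0 < m := by linarith
  have hσ := c.σ_lt_one
  have hσ0 := c.σ_nonneg
  -- The largest angle bound for which `cone_invariance` applies with `η = δ`.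
  set δ := (1 - c.σ) / (18 * m ^ 6) with hδ
  have hδ0 : 0 < δ := div_pos (by linarith) (by positivity)
  have hδm : 18 * (m ^ 6 * δ) = 1 - c.σ := by rw [hδ]; field_simp
  have hδ2 : m * m * δ ≤ m ^ 6 * δ := by
    rw [← pow_two]
    exact mul_le_mul_of_nonneg_right (pow_le_pow_right₀ hm (by norm_num)) hδ0.le
  have hδ12 : 12 * (m * m * δ) ≤ 1 := by linarith
  have hmδ : m * δ ≤ m * m * δ := by
    have := mul_le_mul_of_nonneg_right hm (mul_nonneg hm0.le hδ0.le)
    linarith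
  have hδ1 : δ ≤ m * δ := by
    have := mul_le_mul_of_nonneg_right hm hδ0.le
    linarith
  refine ⟨δ, hδ0, by linarith, fun s θ hs hθ hsθ => ?_⟩
  have hsi : |Real.sin θ| ≤ δ := Real.abs_sin_le_abs.trans hθ.le
  have hS : s * Real.sin θ ≤ δ := by
    refine (le_abs_self _).trans ?_
    rw [abs_mul, hs, one_mul]
    exact hsi
  have hco : 1 / 2 ≤ Real.cos θ := by
    have h1 := Real.one_sub_sq_div_two_le_cos (x := θ)
    have h2 : θ ^ 2 ≤ 1 := by
      rw [← sq_abs]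
      exact pow_le_one₀ (abs_nonneg _) (by linarith)
    linarith
  have hss : s * s = 1 := by rw [← abs_mul_abs_self, hs, one_mul]
  have hαs : ∀ x, |c.shear x * Real.sin θ| ≤ m * δ := fun x => by
    rw [abs_mul]
    exact mul_le_mul (hb x).2.2.2.2.2.1 hsi (abs_nonneg _) hm0.le
  have hβ0 : ∀ x, 0 ≤ (cross (c.f x) (c.e x))⁻¹ := fun x => (inv_pos.2 (c.cross_pos x)).le
  have hcone : ∀ (k : ℝ), 1 ≤ k → k ≤ 2 → ∀ x,
      ‖toMap (A x) (c.e x)‖ * (s * Real.sin θ) * (cross (c.f x) (c.e x))⁻¹ +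
        ‖toMap (A x) (c.e x)‖ * (Real.cos θ - c.shear x * Real.sin θ) * (k * c.g x) ≤
      k * c.g (T x) * (c.growth x * (Real.cos θ + c.shear x * Real.sin θ) -
        c.growth x * (s * Real.sin θ) * (cross (c.f x) (c.e x))⁻¹ * (k * c.g x)) := by
    intro k hk1 hk2 x
    obtain ⟨h1, h2, h3, h4, h5, h6, h7⟩ := hb x
    obtain ⟨-, -, -, h4', h5', -, -⟩ := hb (T x)
    exact cone_invariance hm (norm_nonneg _) h1 h2 h3 (c.g_pos x).le h5 h4' h5' h6 (hβ0 x) h7 hco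
      hsi hsθ hS hσ.le hδm.le hk1 hk2 (c.adapted x)
  have hα : Measurable c.shear := c.continuous_inner_div_cross.neg.measurable
  have hβ : Measurable fun x => (cross (c.f x) (c.e x))⁻¹ := c.continuous_cross.measurable.inv
  have hgr : Measurable c.growth := c.continuous_norm_f.measurable
  have hne := c.continuous_norm_e.measurable
  refine ⟨{
    f := c.f
    -- Flipping `e` by `s` replaces `sin θ` by `s sin θ ≥ 0` off the diagonal, so that `q` and `r`
    -- are nonnegative; the diagonal is unchanged.
    e := fun x => s • c.e x
    sgn := c.sgn
    p := fun x => c.growth x * (Real.cos θ + c.shear x * Real.sin θ)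
    q := fun x => ‖toMap (A x) (c.e x)‖ * (s * Real.sin θ) * (cross (c.f x) (c.e x))⁻¹
    r := fun x => c.growth x * (s * Real.sin θ) * (cross (c.f x) (c.e x))⁻¹
    t := fun x => ‖toMap (A x) (c.e x)‖ * (Real.cos θ - c.shear x * Real.sin θ)
    g := c.g
    K := 4 * m
    measurable_p := hgr.mul (measurable_const.add (hα.mul_const _))
    measurable_q := (hne.mul_const _).mul hβ
    measurable_r := (hgr.mul_const _).mul hβ
    measurable_t := hne.mul (measurable_const.sub (hα.mul_const _))
    abs_sgn := c.abs_sgn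
    map_f := fun x => ?_
    map_e := fun x => ?_
    q_nonneg := fun x => mul_nonneg (mul_nonneg (norm_nonneg _) hsθ) (hβ0 x)
    r_nonneg := fun x => mul_nonneg (mul_nonneg (norm_nonneg _) hsθ) (hβ0 x)
    t_nonneg := fun x => mul_nonneg (norm_nonneg _) (by linarith [(abs_le.1 (hαs x)).2])
    K_pos := by linarith
    le_g := fun x => (inv_anti₀ hm0 (by linarith)).trans (hb x).2.2.2.1
    g_le := fun x => by linarith [(hb x).2.2.2.2.1]
    p_le := fun x => ?_
    le_p := fun x => ?_
    cone_one := fun x => by simpa using hcone 1 le_rfl one_le_two x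
    cone_two := fun x => hcone 2 one_le_two le_rfl x
    norm_le := fun x a b => ?_
    abs_le := fun x a b => ?_
    span := fun x v => ?_ }, fun x => ⟨rfl, rfl⟩⟩
  · have hf := c.map_f x
    have he := c.map_e x
    rw [rotate, toMap_mul_apply, toMap_rotation_left θ (c.norm_f x) (c.cross_pos x).ne', map_add,
      map_smul, map_smul, growth, shear]
    generalize ‖toMap (A x) (c.e x)‖ = a at he ⊢
    generalize ‖toMap (A x) (c.f x)‖ = b at hf ⊢
    have h : a * (s * Real.sin θ) * (cross (c.f x) (c.e x))⁻¹ * s =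
        Real.sin θ / cross (c.f x) (c.e x) * a := by
      rw [div_eq_mul_inv]
      linear_combination (a * Real.sin θ * (cross (c.f x) (c.e x))⁻¹) * hss
    rw [smul_smul _ s, h, hf, he]
    module
  · have hf := c.map_f x
    have he := c.map_e x
    rw [map_smul, rotate, toMap_mul_apply,
      toMap_rotation_right θ (c.norm_e x) (c.cross_pos x).ne', map_add,
      map_smul, map_smul, growth, shear, div_eq_mul_inv (Real.sin θ)]
    generalize ‖toMap (A x) (c.e x)‖ = a at he ⊢
    generalize ‖toMap (A x) (c.f x)‖ = b at hf ⊢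
    rw [hf, he]
    module
  · have h1 : Real.cos θ + c.shear x * Real.sin θ ≤ 2 := by
      linarith [(abs_le.1 (hαs x)).2, Real.cos_le_one θ]
    calc c.growth x * (Real.cos θ + c.shear x * Real.sin θ) ≤ c.growth x * 2 :=
          mul_le_mul_of_nonneg_left h1 (c.growth_pos x).le
      _ ≤ 4 * m := by linarith [(hb x).2.2.1]
  · obtain ⟨h1, h2, h3, h4, h5, h6, h7⟩ := hb x
    exact inv_le_cone_denom hm h2 (c.g_pos x).le h5 h6 (hβ0 x) h7 hco hsi hsθ hS hδ12
  · refine (norm_add_le _ _).trans ?_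
    rw [norm_smul, norm_smul, norm_smul, c.norm_f, c.norm_e, Real.norm_eq_abs, Real.norm_eq_abs,
      Real.norm_eq_abs, hs, mul_one, mul_one, mul_one]
    exact le_mul_of_one_le_left (by positivity) (by linarith)
  · have hD := c.cross_pos x
    set v := a • c.f x + b • s • c.e x with hv
    have hself : ∀ u : Plane, cross u u = 0 := fun u => by simp [cross, mul_comm]
    have h1 : cross v (c.e x) = a * cross (c.f x) (c.e x) := by
      simp only [hv, cross, PiLp.add_apply, PiLp.smul_apply, smul_eq_mul]; ring
    have h2 : cross (c.f x) v = b * s * cross (c.f x) (c.e x) := by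
      simp only [hv, cross, PiLp.add_apply, PiLp.smul_apply, smul_eq_mul]; ring
    have e1 := abs_cross_le v (c.e x)
    have e2 := abs_cross_le (c.f x) v
    rw [h1, c.norm_e, mul_one, abs_mul, abs_of_pos hD] at e1
    rw [h2, c.norm_f, one_mul, abs_mul, abs_mul, hs, mul_one, abs_of_pos hD] at e2
    have h7 := (hb x).2.2.2.2.2.2
    have fin : ∀ y : ℝ, y * cross (c.f x) (c.e x) ≤ ‖v‖ → y ≤ 4 * m * ‖v‖ := fun y hy => by
      rw [← le_div_iff₀ hD, div_eq_mul_inv] at hy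
      have := mul_le_mul_of_nonneg_left h7 (norm_nonneg v)
      have := mul_nonneg hm0.le (norm_nonneg v)
      linarith
    exact ⟨fin _ e1, fin _ e2⟩
  · have hD := (c.cross_pos x).ne'
    have h := cross_mul_smul (c.f x) (c.e x) v
    refine ⟨(cross (c.f x) (c.e x))⁻¹ * cross v (c.e x),
      (cross (c.f x) (c.e x))⁻¹ * cross (c.f x) v * s, ?_⟩
    rw [smul_smul, mul_assoc _ s s, hss, mul_one, mul_smul, mul_smul, ← smul_add, ← h, smul_smul,
      inv_mul_cancel₀ hD, one_smul]

end AdaptedFrame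

end Rotation

theorem det_rotate {X : Type*} (A : X → GL (Fin 2) ℝ) (θ : ℝ) (x : X) :
    (rotate A θ x : Matrix (Fin 2) (Fin 2) ℝ).det = (A x : Matrix (Fin 2) (Fin 2) ℝ).det := by
  have h : (rotation θ : Matrix (Fin 2) (Fin 2) ℝ).det = 1 := by
    simp [Matrix.det_fin_two, rotation, Matrix.GeneralLinearGroup.mkOfDetNeZero, ← pow_two]
  rw [rotate, Units.val_mul, Matrix.det_mul, h, mul_one]

theorem rotate_zero {X : Type*} (A : X → GL (Fin 2) ℝ) : rotate A 0 = A := by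
  funext x
  have h : rotation 0 = 1 := by
    ext i j
    fin_cases i <;> fin_cases j <;> simp [rotation, Matrix.GeneralLinearGroup.mkOfDetNeZero]
  rw [rotate, h, mul_one]

/-! ### Comparison of the exponents -/

section Exponents

variable {X : Type*} [TopologicalSpace X] [MeasurableSpace X] {T : X ≃ₜ X}
  {A : X → GL (Fin 2) ℝ} {μ : Measure X} [IsProbabilityMeasure μ]

theorem IsUpperExponent.unique {L L' : ℝ} (h : IsUpperExponent T A μ L)
    (h' : IsUpperExponent T A μ L') : L = L' := by
  obtain ⟨x, hx, hx'⟩ := (h.and h').exists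
  exact tendsto_nhds_unique hx hx'

theorem IsLowerExponent.unique {L L' : ℝ} (h : IsLowerExponent T A μ L)
    (h' : IsLowerExponent T A μ L') : L = L' := by
  obtain ⟨x, hx, hx'⟩ := (h.and h').exists
  exact tendsto_nhds_unique hx hx'

variable [CompactSpace X] [BorelSpace X]

theorem _root_.Continuous.integrable_of_compactSpace {φ : X → ℝ} (hφ : Continuous φ) :
    Integrable φ μ := by
  obtain ⟨m, hm⟩ := exists_abs_le_of_continuous hφ
  exact Integrable.of_bound hφ.measurable.aestronglyMeasurable m (.of_forall hm)

theorem ConeFrame.isExponents (hμ : Ergodic T μ) (hA : Continuous A) {θ : ℝ}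
    (d : ConeFrame T (rotate A θ)) :
    IsUpperExponent T (rotate A θ) μ (∫ x, d.logGrowth x ∂μ) ∧
    IsLowerExponent T (rotate A θ) μ
      ((∫ x, Real.log |(A x : Matrix (Fin 2) (Fin 2) ℝ).det| ∂μ) - ∫ x, d.logGrowth x ∂μ) := by
  obtain ⟨C, hC, h⟩ := d.exists_const
  have hdet : Continuous fun x => Real.log |(A x : Matrix (Fin 2) (Fin 2) ℝ).det| :=
    ((Units.continuous_val.comp hA).matrix_det.abs).log fun x =>
      abs_ne_zero.2 ((Matrix.isUnit_iff_isUnit_det _).1 (A x).isUnit).ne_zero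
  have hlow := isLowerExponent_of_birkhoffSum (A := rotate A θ) hμ d.measurable_logGrowth
    (d.integrable_logGrowth μ) (by simpa only [det_rotate] using hdet.measurable)
    (by simpa only [det_rotate] using hdet.integrable_of_compactSpace) hC h
  simp only [det_rotate] at hlow
  exact ⟨isUpperExponent_of_birkhoffSum hμ d.measurable_logGrowth (d.integrable_logGrowth μ) hC h,
    hlow⟩

namespace AdaptedFrame

variable (c : AdaptedFrame T A)

/-- Rotating by `θ` changes the top exponent by less than `tan θ` times the mean shear. -/
theorem integral_logGrowth_lt {θ : ℝ} (hθ : θ ≠ 0) (hθ1 : |θ| ≤ 1) (d : ConeFrame T (rotate A θ))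
    (hp : ∀ x, d.p x = c.growth x * (Real.cos θ + c.shear x * Real.sin θ)) :
    ∫ x, d.logGrowth x ∂μ <
      (∫ x, Real.log (c.growth x) ∂μ) + Real.tan θ * ∫ x, c.shear x ∂μ := by
  have hco : 0 < Real.cos θ := Real.cos_pos_of_le_one hθ1
  have hco1 : Real.cos θ < 1 := by
    refine lt_of_le_of_ne (Real.cos_le_one θ) fun h => hθ ?_
    have hpi := Real.pi_gt_three
    obtain ⟨h1, h2⟩ := abs_le.1 hθ1
    exact (Real.cos_eq_one_iff_of_lt_of_lt (by linarith) (by linarith)).1 h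
  -- Dropping `r * slopeLim ≥ 0` leaves `log p`, with `p = growth * cos θ * (1 + tan θ * shear)`,
  -- and `log (1 + t) ≤ t`. The strict inequality of the lemma comes from `log (cos θ) < 0`.
  have hle : ∀ x, d.logGrowth x ≤
      Real.log (c.growth x) + (Real.tan θ * c.shear x + Real.log (Real.cos θ)) := by
    intro x
    have hden := d.denom_pos (d.slopeLim_le_two x)
    have hrz := mul_nonneg (d.r_nonneg x) (d.slopeLim_nonneg x)
    have hp0 : 0 < d.p x := by linarith
    have hgr := c.growth_pos x
    have h1 : d.logGrowth x ≤ Real.log (d.p x) := Real.log_le_log hden (by linarith)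
    have h2 : d.p x = c.growth x * (Real.cos θ * (1 + Real.tan θ * c.shear x)) := by
      rw [hp, Real.tan_eq_sin_div_cos]
      field_simp
    have h3 : 0 < 1 + Real.tan θ * c.shear x := by
      rw [h2] at hp0
      exact pos_of_mul_pos_right (pos_of_mul_pos_right hp0 hgr.le) hco.le
    have h4 := Real.log_le_sub_one_of_pos h3
    rw [h2, Real.log_mul hgr.ne' (mul_pos hco h3).ne', Real.log_mul hco.ne' h3.ne'] at h1
    linarith
  have hi1 : Integrable (fun x => Real.log (c.growth x)) μ :=
    Continuous.integrable_of_compactSpace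
      (Continuous.log c.continuous_norm_f fun x => (c.growth_pos x).ne')
  have hi2 : Integrable c.shear μ := c.continuous_inner_div_cross.neg.integrable_of_compactSpace
  have hi3 : Integrable (fun x => Real.tan θ * c.shear x + Real.log (Real.cos θ)) μ :=
    (hi2.const_mul _).add (integrable_const _)
  have hmono := integral_mono (d.integrable_logGrowth μ) (hi1.add hi3) hle
  have hlog := Real.log_neg hco hco1
  have hsum : ∫ x, (Real.log (c.growth x) +
      (Real.tan θ * c.shear x + Real.log (Real.cos θ))) ∂μ =
      (∫ x, Real.log (c.growth x) ∂μ) +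
        (Real.tan θ * (∫ x, c.shear x ∂μ) + Real.log (Real.cos θ)) := by
    rw [integral_add hi1 hi3,
      integral_add (hi2.const_mul (Real.tan θ)) (integrable_const _), integral_const_mul]
    simp
  have hmono' := hmono.trans_eq hsum
  linarith

end AdaptedFrame

end Exponents

/-- Small rotations towards the side `s = ±1` on which the mean shear is not positive strictly
bring the two exponents together. -/
theorem AdaptedFrame.exists_exponents {X : Type*} [TopologicalSpace X] [CompactSpace X]
    [MeasurableSpace X] [BorelSpace X] {T : X ≃ₜ X} {μ : Measure X} [IsProbabilityMeasure μ]
    (hμ : Ergodic T μ) {A : X → GL (Fin 2) ℝ} (hA : Continuous A) (c : AdaptedFrame T A) :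
    ∃ ε lp lm : ℝ, 0 < ε ∧ IsUpperExponent T A μ lp ∧ IsLowerExponent T A μ lm ∧
      ∀ s : ℝ, |s| = 1 → s * ∫ x, c.shear x ∂μ ≤ 0 → ∀ θ, 0 < s * θ → |θ| < ε →
        ∃ lp' lm', IsUpperExponent T (rotate A θ) μ lp' ∧ IsLowerExponent T (rotate A θ) μ lm' ∧
          lp' < lp ∧ lm < lm' := by
  obtain ⟨δ, hδ, hδ1, hframe⟩ := c.exists_coneFrame
  -- At `θ = 0` the frame has `r = 0` and `p = growth`, so the same machinery gives the exponents of
  -- `A` itself.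
  obtain ⟨d₀, hd₀⟩ := hframe 1 0 abs_one (by simpa using hδ) (by simp)
  have h0 : ∀ x, d₀.logGrowth x = Real.log (c.growth x) := fun x => by
    rw [ConeFrame.logGrowth, (hd₀ x).1, (hd₀ x).2]
    simp
  obtain ⟨hup, hlow⟩ := d₀.isExponents hμ hA
  simp only [h0, rotate_zero] at hup hlow
  refine ⟨δ, _, _, hδ, hup, hlow, fun s hs hshear θ hsθ hθ => ?_⟩
  have hθ0 : θ ≠ 0 := right_ne_zero_of_mul hsθ.ne'
  have hθ1 : |θ| ≤ 1 := hθ.le.trans hδ1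
  obtain ⟨hθl, hθr⟩ := abs_le.1 hθ1
  have hpi := Real.pi_gt_three
  have hside : 0 ≤ s * Real.sin θ ∧ Real.tan θ * ∫ x, c.shear x ∂μ ≤ 0 := by
    rcases eq_or_eq_neg_of_abs_eq hs with rfl | rfl
    · rw [one_mul] at hsθ hshear ⊢
      exact ⟨Real.sin_nonneg_of_nonneg_of_le_pi hsθ.le (by linarith),
        mul_nonpos_of_nonneg_of_nonpos
          (Real.tan_nonneg_of_nonneg_of_le_pi_div_two hsθ.le (by linarith)) hshear⟩
    · have hneg : θ < 0 := by linarith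
      refine ⟨?_, mul_nonpos_of_nonpos_of_nonneg
          (Real.tan_nonpos_of_nonpos_of_neg_pi_div_two_le hneg.le (by linarith)) (by linarith)⟩
      have := Real.sin_nonpos_of_nonpos_of_neg_pi_le hneg.le (by linarith)
      linarith
  obtain ⟨d, hd⟩ := hframe s θ hs hθ hside.1
  obtain ⟨hup', hlow'⟩ := d.isExponents hμ hA
  have hlt := c.integral_logGrowth_lt (μ := μ) hθ0 hθ1 d fun x => (hd x).1
  exact ⟨_, _, hup', hlow', by linarith [hside.2], by linarith [hside.2]⟩

end LinearCocycle

theorem mainTheorem4 {X : Type*} [MetricSpace X] [CompactSpace X] [MeasurableSpace X]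
    [BorelSpace X] (T : X ≃ₜ X) (μ : Measure X) [IsProbabilityMeasure μ] (hμ : Ergodic T μ)
    (A : X → GL (Fin 2) ℝ) (hA : Continuous A)
    (hdet : ∀ x, 0 < (A x : Matrix (Fin 2) (Fin 2) ℝ).det)
    (hdom : LinearCocycle.HasDominatedSplitting T A) :
    ∃ (ε : ℝ) (I : Set ℝ), 0 < ε ∧ (I = Set.Ioo 0 ε ∨ I = Set.Ioo (-ε) 0) ∧
      ∃ (lp lm : ℝ) (lpθ lmθ : ℝ → ℝ),
        LinearCocycle.IsUpperExponent T A μ lp ∧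
        LinearCocycle.IsLowerExponent T A μ lm ∧
        (∀ θ ∈ I,
          LinearCocycle.IsUpperExponent T (LinearCocycle.rotate A θ) μ (lpθ θ) ∧
          LinearCocycle.IsLowerExponent T (LinearCocycle.rotate A θ) μ (lmθ θ) ∧
          lpθ θ < lp ∧ lm < lmθ θ) ∧
        (¬ ∃ c, ∀ θ ∈ insert 0 I,
          LinearCocycle.IsUpperExponent T (LinearCocycle.rotate A θ) μ c) ∧
        (¬ ∃ c, ∀ θ ∈ insert 0 I,
          LinearCocycle.IsLowerExponent T (LinearCocycle.rotate A θ) μ c) := by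
  obtain ⟨c⟩ := LinearCocycle.exists_adaptedFrame hA hdet hdom
  obtain ⟨ε, lp, lm, hε, hlp, hlm, h⟩ := c.exists_exponents hμ hA
  obtain ⟨I, hI, hIne, hIθ⟩ : ∃ I : Set ℝ, (I = Set.Ioo 0 ε ∨ I = Set.Ioo (-ε) 0) ∧ I.Nonempty ∧
      ∀ θ, θ ∈ I → ∃ lp' lm', LinearCocycle.IsUpperExponent T (LinearCocycle.rotate A θ) μ lp' ∧
        LinearCocycle.IsLowerExponent T (LinearCocycle.rotate A θ) μ lm' ∧
        lp' < lp ∧ lm < lm' := by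
    -- The sign of the mean shear decides the side: there the first-order term `tan θ ∫ shear` is
    -- not positive.
    rcases le_total (∫ x, c.shear x ∂μ) 0 with hs | hs
    · refine ⟨_, Or.inl rfl, Set.nonempty_Ioo.2 hε, fun θ hθ => ?_⟩
      exact h 1 abs_one (by linarith) θ (by linarith [hθ.1])
        (abs_lt.2 ⟨by linarith [hθ.1], hθ.2⟩)
    · refine ⟨_, Or.inr rfl, Set.nonempty_Ioo.2 (by linarith), fun θ hθ => ?_⟩
      exact h (-1) (by simp) (by linarith) θ (by linarith [hθ.2])
        (abs_lt.2 ⟨hθ.1, by linarith [hθ.2]⟩)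
  choose! lpθ lmθ hup hlow hlt hlt' using hIθ
  obtain ⟨θ, hθ⟩ := hIne
  refine ⟨ε, I, hε, hI, lp, lm, lpθ, lmθ, hlp, hlm,
    fun θ hθ => ⟨hup θ hθ, hlow θ hθ, hlt θ hθ, hlt' θ hθ⟩, ?_, ?_⟩
  · rintro ⟨k, hk⟩
    have h0 := hk 0 (Set.mem_insert _ _)
    rw [LinearCocycle.rotate_zero] at h0
    have e1 := h0.unique hlp
    have e2 := (hk θ (Set.mem_insert_of_mem _ hθ)).unique (hup θ hθ)
    linarith [hlt θ hθ]
  · rintro ⟨k, hk⟩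
    have h0 := hk 0 (Set.mem_insert _ _)
    rw [LinearCocycle.rotate_zero] at h0
    have e1 := h0.unique hlm
    have e2 := (hk θ (Set.mem_insert_of_mem _ hθ)).unique (hlow θ hθ)
    linarith [hlt' θ hθ]
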